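/- Let $\overline{\mathbb Q}$ be an algebraic closure of $\mathbb Q$, and let $h:\overline{\mathbb Q}\to\mathbb R_{\ge 0}$ be the absolute logarithmic Weil height: for $\alpha$ in a number field $K$, $h(\alpha)=\sum_v \log\max(1,|\alpha|_v)$, the sum being over all places $v$ of $K$, where $|\alpha|_v=|N_{K_v/\mathbb Q_p}(\alpha)|_p^{1/[K:\mathbb Q]}$ for $v$ lying over the place $p\le\infty$ of $\mathbb Q$ (this does not depend on the choice of $K$). **Theorem 1.4.** Let $r\ge 0$ be an integer, let $f:\mathbb A^r_{\overline{\mathbb Q}}\to\mathbb A^r_{\overline{\mathbb Q}}$ and $\lambda:\mathbb A^r_{\overline{\mathbb Q}}\to\mathbb A^1_{\overline{\mathbb Q}}$ be regular maps, that is, maps given by polynomials with coefficients in $\overline{\mathbb Q}$, and let $P\in\mathbb A^r(\overline{\mathbb Q})$. Write $f^n$ for the $n$-th iterate of $f$, and suppose that $$\limsup_{n\to\infty}\frac{\log h(\lambda(f^nP))}{\log n}<\frac1r ,$$ where $\log 0=-\infty$, the limit superior is taken in $[-\infty,+\infty]$, and $1/r=+\infty$ if $r=0$. Then there are an integer $d\ge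 1$ and polynomials $p_0,\dots,p_{d-1}\in\overline{\mathbb Q}[x]$ such that, for all sufficiently large $n\in\mathbb N$, $$\lambda(f^{nd+i}P)=p_i(n)\qquad\text{for all } i=0,\dots,d-1 .$$ -/

import Mathlib

open Filter
open scoped ENNReal

/-- The field of algebraic numbers. -/
abbrev QBar : Type := AlgebraicClosure ℚ

/-- A regular map from affine `r`-space to affine `s`-space over the algebraically closed field
`K`, given on `K`-points: every coordinate is a polynomial in the coordinates of the point. -/
def IsRegularMap {K : Type*} [Field K] {r s : ℕ} (f : (Fin r → K) → (Fin s → K)) : Prop :=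
  ∃ F : Fin s → MvPolynomial (Fin r) K, ∀ x i, f x i = MvPolynomial.eval x (F i)

/-- A regular map from affine `r`-space to the affine line over the algebraically closed field
`K`, given on `K`-points. -/
def IsRegularFunction {K : Type*} [Field K] {r : ℕ} (l : (Fin r → K) → K) : Prop :=
  ∃ F : MvPolynomial (Fin r) K, ∀ x, l x = MvPolynomial.eval x F

/-- `log h(a)` for the absolute logarithmic Weil height `h` of an algebraic number `a`, as an
extended real number; it is `-∞` when `h(a) = 0`. -/
noncomputable def logWeilHeight (a : QBar) : EReal :=
  ENNReal.log (ENNReal.ofReal (NumberField.absLogHeight₁ a))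

/-! Write a(n) = λ(fⁿP). All a(n) lie in one number field K, and a(n) has height O((n+1)^c) for some
0 < c < 1/r. The main point is that the N × N Hankel determinant of a vanishes for large N.

Suppose it does not vanish. The archimedean places and the finitely many places of bad reduction
contribute at most exp(O(N^(1+c))) to the product formula. At a good place with residue field of
size q, the orbit mod v moves among q^r points. So if q^r ≤ N/2, column operations make at least N/2
columns divisible by v, and the determinant has absolute value at most 2^(-N/2) there. For c < c' <
1/r there are at least (N/2)^c' primes with q ≤ (N/2)^(1/r), so these places contribute exp(-const ·
N^(1+c')), contradicting the product formula (`exists_forall_det_hankel_orbitValue_eq_zero`). The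
saving of only 2 per column means that a prime count of X^(1-δ) suffices; it follows from the
asymptotic ideal count by a Chebyshev–Mertens argument (`eventually_rpow_le_card_primesNormLE`).

By Kronecker's criterion a is then a linear recurrence sequence
(`recurrenceIdeal_ne_bot_of_det_hankel`). For a nonzero root α of its minimal polynomial, α^n is up
to a nonzero constant a fixed combination of shifts of a, so n·h(α) = O(n^c) with c < 1. Hence h(α)
= 0 and α is a root of unity (`exists_pow_eq_one_of_moment`). A recurrence whose roots are zero or
roots of unity is eventually polynomial on residue classes (`eventually_quasiPolynomial_of_roots`).
-/

/-! ### Linear recurrences, Hankel determinants and quasi-polynomials. -/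

section LinearRecurrences

open Polynomial

variable {F : Type*} [Field F]

/-- The linear functional on polynomials sending `X ^ n` to `a n`. -/
noncomputable def moment (a : ℕ → F) : F[X] →ₗ[F] F :=
  Polynomial.lsum fun n => a n • LinearMap.id

@[simp]
lemma moment_monomial (a : ℕ → F) (n : ℕ) (c : F) : moment a (monomial n c) = a n * c := by
  simp [moment, Polynomial.lsum_apply, Polynomial.sum_monomial_index]

@[simp]
lemma moment_X_pow (a : ℕ → F) (n : ℕ) : moment a (X ^ n) = a n := by
  rw [← monomial_one_right_eq_X_pow, moment_monomial, mul_one]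

lemma moment_X_pow_mul (a : ℕ → F) (i : ℕ) (p : F[X]) :
    moment a (X ^ i * p) = ∑ j ∈ Finset.range (p.natDegree + 1), a (i + j) * p.coeff j := by
  conv_lhs => rw [p.as_sum_range, Finset.mul_sum, map_sum]
  refine Finset.sum_congr rfl fun j _ => ?_
  rw [X_pow_mul_monomial, moment_monomial, add_comm]

lemma moment_mul_eq_zero_of_degree_lt (a : ℕ → F) {p q : F[X]} {m : ℕ} (hq : q.degree < m)
    (h : ∀ i < m, moment a (X ^ i * p) = 0) : moment a (q * p) = 0 := by
  rw [q.as_sum_support_C_mul_X_pow, Finset.sum_mul, map_sum]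
  refine Finset.sum_eq_zero fun i hi => ?_
  have him : i < m := by
    exact_mod_cast (le_degree_of_mem_supp i hi).trans_lt hq
  rw [mul_assoc, ← smul_eq_C_mul, map_smul, h i him, smul_zero]

/-- The ideal of characteristic polynomials of the linear recurrences satisfied by `a`. -/
def recurrenceIdeal (a : ℕ → F) : Ideal F[X] where
  carrier := {p | ∀ q, moment a (q * p) = 0}
  add_mem' hp hq r := by rw [mul_add, map_add, hp r, hq r, add_zero]
  zero_mem' q := by simp
  smul_mem' c p hp q := by rw [smul_eq_mul, ← mul_assoc]; exact hp _

lemma mem_recurrenceIdeal {a : ℕ → F} {p : F[X]} :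
    p ∈ recurrenceIdeal a ↔ ∀ q, moment a (q * p) = 0 := Iff.rfl

lemma mem_recurrenceIdeal_of_X_pow {a : ℕ → F} {p : F[X]}
    (h : ∀ i, moment a (X ^ i * p) = 0) : p ∈ recurrenceIdeal a := fun q =>
  moment_mul_eq_zero_of_degree_lt a (m := q.natDegree + 1)
    (degree_lt_iff_coeff_zero _ _ |>.2 fun _ hn => coeff_eq_zero_of_natDegree_lt hn)
    fun i _ => h i

/-- The `N × N` Hankel matrix of a sequence. -/
def hankel {R : Type*} (a : ℕ → R) (N : ℕ) : Matrix (Fin N) (Fin N) R :=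
  Matrix.of fun i j => a (i + j)

lemma hankel_apply {R : Type*} (a : ℕ → R) (N : ℕ) (i j : Fin N) : hankel a N i j = a (i + j) :=
  rfl

lemma hankel_mulVec (a : ℕ → F) (N : ℕ) (p : degreeLT F N) (i : Fin N) :
    (hankel a N).mulVec (degreeLTEquiv F N p) i = moment a (X ^ (i : ℕ) * p.1) := by
  conv_rhs => rw [← (degreeLTEquiv F N).symm_apply_apply p]
  simp only [degreeLTEquiv, LinearEquiv.coe_symm_mk, Matrix.mulVec, dotProduct, hankel_apply]
  simp [Finset.mul_sum, X_pow_mul_monomial, add_comm]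

lemma det_hankel_eq_zero_iff (a : ℕ → F) (N : ℕ) :
    (hankel a N).det = 0 ↔
      ∃ p : F[X], p ≠ 0 ∧ p.degree < N ∧ ∀ i < N, moment a (X ^ i * p) = 0 := by
  rw [← Matrix.exists_mulVec_eq_zero_iff]
  constructor
  · rintro ⟨v, hv, h⟩
    refine ⟨((degreeLTEquiv F N).symm v).1, ?_, mem_degreeLT.1 ((degreeLTEquiv F N).symm v).2,
      fun i hi => ?_⟩
    · simpa using hv
    · have := hankel_mulVec a N ((degreeLTEquiv F N).symm v) ⟨i, hi⟩
      rw [LinearEquiv.apply_symm_apply, h] at this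
      exact this.symm
  · rintro ⟨p, hp, hd, h⟩
    refine ⟨degreeLTEquiv F N ⟨p, mem_degreeLT.2 hd⟩, ?_, ?_⟩
    · simpa [Subtype.ext_iff] using hp
    · ext i
      rw [hankel_mulVec]
      exact h i i.2

/-- **Kronecker's criterion**: a sequence whose Hankel determinants eventually vanish satisfies a
linear recurrence. -/
theorem recurrenceIdeal_ne_bot_of_det_hankel (a : ℕ → F)
    (h : ∃ N₀, ∀ N ≥ N₀, (hankel a N).det = 0) : recurrenceIdeal a ≠ ⊥ := by
  classical
  -- s is the last size with nonzero determinant; it exists because the 0 × 0 determinant is 1.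
  obtain ⟨s, hs, hs'⟩ : ∃ s, (hankel a s).det ≠ 0 ∧ ∀ N > s, (hankel a N).det = 0 := by
    have h0 : Nat.find h ≠ 0 := fun h0 => by
      have := Nat.find_spec h 0 (by omega)
      simp at this
    refine ⟨Nat.find h - 1, fun hz => ?_, fun N hN => Nat.find_spec h N (by omega)⟩
    refine Nat.find_min h (m := Nat.find h - 1) (by omega) fun N hN => ?_
    rcases hN.eq_or_lt with rfl | hN
    · exact hz
    · exact Nat.find_spec h N (by omega)
  have hs0 : ∀ p : F[X], p.degree < s → (∀ i < s, moment a (X ^ i * p) = 0) → p = 0 := by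
    intro p hp hi
    by_contra hne
    exact hs ((det_hankel_eq_zero_iff a s).2 ⟨p, hne, hp, hi⟩)
  obtain ⟨U, hU0, hUd, hU⟩ := (det_hankel_eq_zero_iff a (s + 1)).1 (hs' _ (Nat.lt_succ_self s))
  have hUs : U.degree = s := by
    have h1 : ¬ U.degree < s := fun h1 => hU0 (hs0 U h1 fun i hi => hU i (by omega))
    rw [degree_eq_natDegree hU0] at *
    norm_cast at *
    omega
  obtain ⟨P, hPm, hPd, hP⟩ : ∃ P : F[X], P.Monic ∧ P.degree = s ∧
      ∀ i < s + 1, moment a (X ^ i * P) = 0 := by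
    refine ⟨U * C U.leadingCoeff⁻¹, monic_mul_leadingCoeff_inv hU0, ?_, fun i hi => ?_⟩
    · rw [degree_mul_leadingCoeff_inv _ hU0, hUs]
    · rw [mul_comm U, ← smul_eq_C_mul, mul_smul_comm, map_smul, hU i hi, smul_zero]
  have hPn : P.natDegree = s := natDegree_eq_of_degree_eq_some hPd
  -- The kernel vector of size s + 1, made monic, annihilates all shifts: each larger singular
  -- Hankel matrix has a kernel polynomial V divisible by P, which yields one more vanishing moment.
  have key : ∀ m, s + 1 ≤ m → ∀ i < m, moment a (X ^ i * P) = 0 := by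
    intro m hm
    induction m, hm using Nat.le_induction with
    | base => exact hP
    | succ m hm ih =>
      intro i hi
      rcases (Nat.lt_succ_iff.1 hi).lt_or_eq with hi | rfl
      · exact ih i hi
      obtain ⟨V, hV0, hVd, hV⟩ := (det_hankel_eq_zero_iff a (i + 1)).1 (hs' _ (by omega))
      have hVn : V.natDegree ≤ i := by
        rw [degree_eq_natDegree hV0] at hVd
        norm_cast at hVd
        omega
      have hQn : (V /ₘ P).natDegree = V.natDegree - s := by rw [natDegree_divByMonic _ hPm, hPn]
      have hdiv := modByMonic_add_div V P
      -- The remainder has degree below s and its first s moments vanish, so nonsingularity at size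
      -- s kills it.
      have hR : V %ₘ P = 0 := by
        refine hs0 _ ((degree_modByMonic_lt V hPm).trans_eq hPd) fun k hk => ?_
        rw [eq_sub_of_add_eq hdiv, mul_sub, map_sub, hV k (by omega), zero_sub, neg_eq_zero,
          mul_comm P, ← mul_assoc]
        refine moment_mul_eq_zero_of_degree_lt a (m := i) ?_ ih
        refine (degree_le_natDegree).trans_lt ?_
        have : (X ^ k * (V /ₘ P)).natDegree ≤ k + (V.natDegree - s) :=
          natDegree_mul_le.trans (by rw [natDegree_X_pow, hQn])
        exact_mod_cast (by omega : (X ^ k * (V /ₘ P)).natDegree < i)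
      rw [hR, zero_add] at hdiv
      set Q := V /ₘ P with hQ
      have hQ0 : Q ≠ 0 := by
        rintro h0
        rw [h0, mul_zero] at hdiv
        exact hV0 hdiv.symm
      set e := Q.natDegree with he
      have hei : e ≤ i := by omega
      have h1 := hV (i - e) (by omega)
      -- The shift brings the leading term of Q to X ^ i; all other terms have degree below i and
      -- vanish by induction.
      have h2 : X ^ (i - e) * V = (X ^ (i - e) * Q.eraseLead) * P
          + C Q.leadingCoeff * (X ^ i * P) := by
        conv_lhs => rw [← hdiv, ← Q.eraseLead_add_C_mul_X_pow, ← he]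
        have : (X : F[X]) ^ i = X ^ (i - e) * X ^ e := by rw [← pow_add]; congr 1; omega
        rw [this]
        ring
      rw [h2, map_add, ← smul_eq_C_mul, map_smul, smul_eq_mul] at h1
      have h3 : moment a ((X ^ (i - e) * Q.eraseLead) * P) = 0 := by
        refine moment_mul_eq_zero_of_degree_lt a (m := i) ?_ ih
        rw [degree_mul, degree_X_pow]
        have h4 : Q.eraseLead.degree < e := (degree_eraseLead_lt hQ0).trans_eq
          (degree_eq_natDegree hQ0)
        calc ((i - e : ℕ) : WithBot ℕ) + Q.eraseLead.degree < (i - e : ℕ) + (e : ℕ) :=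
              WithBot.add_lt_add_left (by simp) h4
          _ = i := by norm_cast; omega
      rw [h3, zero_add] at h1
      exact (mul_eq_zero.1 h1).resolve_left (leadingCoeff_ne_zero.2 hQ0)
  intro hbot
  have : P ∈ recurrenceIdeal a :=
    mem_recurrenceIdeal_of_X_pow fun i => key (s + 1 + i) (by omega) i (by omega)
  rw [hbot, Ideal.mem_bot] at this
  exact hPm.ne_zero this

lemma exists_polynomial_eval_eq_choose [CharZero F] (k : ℕ) :
    ∃ p : F[X], ∀ n : ℕ, p.eval (n : F) = n.choose k := by
  refine ⟨C ((k.factorial : F)⁻¹) * descPochhammer F k, fun n => ?_⟩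
  have hk : (k.factorial : F) ≠ 0 := by exact_mod_cast k.factorial_ne_zero
  rw [eval_mul, eval_C, descPochhammer_eval_eq_descFactorial, Nat.descFactorial_eq_factorial_mul_choose]
  push_cast
  field_simp

/-- A sequence with a vanishing iterated difference is polynomial. -/
lemma exists_polynomial_of_fwdDiff_iter_eq_zero [CharZero F] {u : ℕ → F} {M : ℕ}
    (h : (fwdDiff 1)^[M] u = 0) : ∃ p : F[X], ∀ n : ℕ, u n = p.eval (n : F) := by
  choose b hb using exists_polynomial_eval_eq_choose (F := F)
  have hzero : ∀ k ≥ M, (fwdDiff 1)^[k] u = 0 := by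
    intro k hk
    obtain ⟨j, rfl⟩ := Nat.exists_eq_add_of_le' hk
    rw [Function.iterate_add_apply, h]
    induction j with
    | zero => rfl
    | succ j ih =>
      rw [Function.iterate_succ_apply', ih (by omega)]
      ext; simp [fwdDiff]
  -- Newton's forward difference formula, cut off at order M.
  refine ⟨∑ k ∈ Finset.range M, C ((fwdDiff 1)^[k] u 0) * b k, fun n => ?_⟩
  have h1 := shift_eq_sum_fwdDiff_iter 1 u n 0
  simp only [smul_eq_mul, mul_one, zero_add] at h1
  rw [h1, eval_finsetSum]
  simp only [eval_mul, eval_C, hb, nsmul_eq_mul]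
  rcases le_total M (n + 1) with hM | hM
  · rw [← Finset.sum_subset (Finset.range_mono hM)]
    · exact Finset.sum_congr rfl fun k _ => mul_comm _ _
    · intro k _ hk
      rw [hzero k (by simpa using hk)]
      simp
  · rw [← Finset.sum_subset (Finset.range_mono hM)]
    · exact Finset.sum_congr rfl fun k _ => mul_comm _ _
    · intro k _ hk
      rw [Nat.choose_eq_zero_of_lt (by simpa using hk)]
      simp

/-- Raising the index k by one multiplies by X ^ d inside `moment`, so a difference in k is
multiplication by X ^ d - 1. -/
lemma fwdDiff_iter_moment (a : ℕ → F) (d i M : ℕ) (p : F[X]) :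
    (fwdDiff 1)^[M] (fun k : ℕ => moment a (X ^ (k * d + i) * p)) =
      fun k => moment a (X ^ (k * d + i) * ((X ^ d - 1) ^ M * p)) := by
  induction M generalizing p with
  | zero => simp
  | succ M ih =>
    rw [Function.iterate_succ_apply]
    have : fwdDiff 1 (fun k : ℕ => moment a (X ^ (k * d + i) * p)) =
        fun k => moment a (X ^ (k * d + i) * ((X ^ d - 1) * p)) := by
      ext k
      rw [fwdDiff, ← map_sub]
      congr 1
      ring
    rw [this, ih]
    ext k
    congr 1
    ring

/-- A linear recurrence sequence whose characteristic roots are zero or roots of unity is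
eventually polynomial on residue classes. -/
theorem eventually_quasiPolynomial_of_roots [CharZero F] {a : ℕ → F} {p : F[X]}
    (hp0 : p ≠ 0) (hp : p ∈ recurrenceIdeal a) (hs : p.Splits)
    (hr : ∀ α ∈ p.roots, α ≠ 0 → ∃ d > 0, α ^ d = 1) :
    ∃ d : ℕ, 0 < d ∧ ∃ q : Fin d → F[X], ∀ᶠ n : ℕ in atTop, ∀ i : Fin d,
      a (n * d + (i : ℕ)) = (q i).eval (n : F) := by
  classical
  obtain ⟨d, hd, hdr⟩ : ∃ d > 0, ∀ α ∈ p.roots, α ≠ 0 → α ^ d = 1 := by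
    choose! e he using hr
    refine ⟨∏ α ∈ p.roots.toFinset with α ≠ 0, e α, Finset.prod_pos fun α hα => ?_, ?_⟩
    · simp only [Finset.mem_filter, Multiset.mem_toFinset] at hα
      exact (he α hα.1 hα.2).1
    · intro α hα hα0
      obtain ⟨c, hc⟩ := Finset.dvd_prod_of_mem e
        (show α ∈ p.roots.toFinset.filter (· ≠ 0) by simp [hα0, Multiset.mem_toFinset, hα])
      rw [hc, pow_mul, (he α hα hα0).2, one_pow]
  set M := Multiset.card p.roots
  -- Each of the M linear factors of p divides X * (X ^ d - 1).
  have hdvd : p ∣ (X * (X ^ d - 1)) ^ M := by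
    rw [hs.eq_prod_roots]
    refine (C_mul_dvd (leadingCoeff_ne_zero.2 hp0)).2 ?_
    have h1 : ∀ q ∈ p.roots.map (fun α => X - C α), q ∣ X * (X ^ d - 1) := by
      intro q hq
      obtain ⟨α, hα, rfl⟩ := Multiset.mem_map.1 hq
      rw [dvd_iff_isRoot, IsRoot.def]
      by_cases hα0 : α = 0
      · simp [hα0]
      · simp [hdr α hα hα0]
    have := Multiset.prod_dvd_prod_of_dvd (S := p.roots) (fun α => X - C α)
      (fun _ => X * (X ^ d - 1)) fun α hα => h1 _ (Multiset.mem_map_of_mem _ hα)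
    simpa using this
  have hmem : (X * (X ^ d - 1)) ^ M ∈ recurrenceIdeal a := Ideal.mem_of_dvd _ hdvd hp
  -- Starting M blocks late supplies the factor X ^ M, since M * d ≥ M; the factor (X ^ d - 1) ^ M
  -- is the M-th difference.
  have hpoly : ∀ i : Fin d, ∃ q : F[X], ∀ k : ℕ, a ((k + M) * d + i) = q.eval (k : F) := by
    intro i
    refine exists_polynomial_of_fwdDiff_iter_eq_zero (M := M) ?_
    have h1 : (fun k : ℕ => a ((k + M) * d + i)) =
        fun k : ℕ => moment a (X ^ (k * d + (M * d + i)) * 1) := by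
      ext k
      rw [mul_one, moment_X_pow]
      congr 1
      ring
    rw [h1, fwdDiff_iter_moment]
    ext k
    obtain ⟨c, hc⟩ := Nat.exists_eq_add_of_le (Nat.le_mul_of_pos_right M hd)
    have h2 : (X : F[X]) ^ (k * d + (M * d + i)) * ((X ^ d - 1) ^ M * 1) =
        X ^ (k * d + c + i) * (X * (X ^ d - 1)) ^ M := by
      rw [hc, mul_pow]
      ring
    rw [h2]
    exact hmem _
  choose q hq using hpoly
  refine ⟨d, hd, fun i => (q i).comp (X - C (M : F)), ?_⟩
  filter_upwards [eventually_ge_atTop M] with n hn i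
  obtain ⟨k, rfl⟩ := Nat.exists_eq_add_of_le' hn
  rw [hq]
  simp

end LinearRecurrences

/-! ### Many primes from an asymptotically linear count of integers. -/

section ChebyshevMertens

open Real Topology

/-- A Chebyshev–Mertens argument for generalised primes: if the counting function `A` of a system of
generalised integers is asymptotically linear, then the prime powers up to `X`, counted with the
von Mangoldt weight `w`, have total weight at least `X ^ (1 - δ)`. Here `L` is the summatory
function of the logarithm, and `q` is the size of a prime power. -/
theorem eventually_rpow_le_sum_vonMangoldt {ι : Type*} (q w : ι → ℝ) (S : ℝ → Finset ι)
    (A L : ℝ → ℝ) {κ δ : ℝ} (hκ : 0 < κ) (hδ : 0 < δ) (hδ1 : δ < 1)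
    (hS : ∀ X i, i ∈ S X ↔ q i ≤ X) (hq : ∀ i, 1 ≤ q i) (hw : ∀ i, 0 ≤ w i)
    (hA : Tendsto (fun x => A x / x) atTop (𝓝 κ)) (hmono : Monotone A) (hA0 : ∀ x, 0 ≤ A x)
    (hL : ∀ X, L X = ∑ i ∈ S X, w i * A (X / q i))
    (hLle : ∀ X, 1 ≤ X → L X ≤ A X * log X)
    (hLge : ∀ X Y, 1 ≤ Y → Y ≤ X → (A X - A Y) * log Y ≤ L X) :
    ∀ᶠ X in atTop, X ^ (1 - δ) ≤ ∑ i ∈ S X, w i := by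
  -- The losses below add up to 9η, which must stay well under δ.
  obtain ⟨η, hη⟩ : ∃ η, η = δ / 20 := ⟨_, rfl⟩
  have hη0 : 0 < η := by linarith
  have hη1 : η < 1 / 20 := by linarith
  obtain ⟨x₀, hx₀1, hlow, hup⟩ : ∃ x₀, 1 ≤ x₀ ∧ (∀ x ≥ x₀, (1 - η) * κ * x ≤ A x) ∧
      ∀ x ≥ x₀, A x ≤ (1 + η) * κ * x := by
    have h1 : ∀ᶠ x in atTop, (1 - η) * κ < A x / x :=
      hA.eventually (lt_mem_nhds (by nlinarith))
    have h2 : ∀ᶠ x in atTop, A x / x < (1 + η) * κ :=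
      hA.eventually (gt_mem_nhds (by nlinarith))
    obtain ⟨x₀, hx₀⟩ := eventually_atTop.1 (h1.and h2)
    refine ⟨max x₀ 1, le_max_right _ _, fun x hx => ?_, fun x hx => ?_⟩
    · have hx1 : 0 < x := by linarith [le_max_right x₀ 1]
      exact ((lt_div_iff₀ hx1).1 (hx₀ x ((le_max_left _ _).trans hx)).1).le
    · have hx1 : 0 < x := by linarith [le_max_right x₀ 1]
      exact ((div_lt_iff₀ hx1).1 (hx₀ x ((le_max_left _ _).trans hx)).2).le
  have hx₀0 : 0 < x₀ := by linarith
  have hSmono : ∀ {X Y}, Y ≤ X → S Y ⊆ S X := fun h i hi =>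
    (hS _ _).2 (((hS _ _).1 hi).trans h)
  -- Mertens' upper bound. Evaluating L at Y * x₀ keeps every argument Y * x₀ / q with q ≤ Y in the
  -- range where the lower bound for A holds.
  have hM : ∀ Y, 1 ≤ Y → (1 - η) * ∑ i ∈ S Y, w i / q i ≤ (1 + η) * (log Y + log x₀) := by
    intro Y hY
    have hY0 : 0 < Y := by linarith
    have hZ : x₀ ≤ Y * x₀ := by nlinarith
    have hZ0 : 0 < Y * x₀ := by positivity
    have h1 : (1 - η) * κ * (Y * x₀) * ∑ i ∈ S Y, w i / q i ≤ L (Y * x₀) := by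
      rw [hL, Finset.mul_sum]
      refine le_trans (Finset.sum_le_sum fun i hi => ?_)
        (Finset.sum_le_sum_of_subset_of_nonneg (hSmono (by nlinarith : Y ≤ Y * x₀))
          fun i _ _ => mul_nonneg (hw i) (hA0 _))
      have hqi : 0 < q i := zero_lt_one.trans_le (hq i)
      have h2 : x₀ ≤ Y * x₀ / q i := by
        rw [le_div_iff₀ hqi]
        nlinarith [(hS _ _).1 hi]
      calc (1 - η) * κ * (Y * x₀) * (w i / q i) = w i * ((1 - η) * κ * (Y * x₀ / q i)) := by ring
        _ ≤ _ := mul_le_mul_of_nonneg_left (hlow _ h2) (hw i)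
    have h2 := (h1.trans (hLle _ (hx₀1.trans hZ))).trans
      (mul_le_mul_of_nonneg_right (hup _ hZ) (log_nonneg (hx₀1.trans hZ)))
    rw [log_mul hY0.ne' hx₀0.ne'] at h2
    have h3 : κ * (Y * x₀) * ((1 - η) * ∑ i ∈ S Y, w i / q i) ≤
        κ * (Y * x₀) * ((1 + η) * (log Y + log x₀)) := by linarith
    exact le_of_mul_le_mul_left h3 (by positivity)
  have hpow : ∀ s : ℝ, 0 < s → Tendsto (fun X : ℝ => X ^ s) atTop atTop := fun s hs =>
    tendsto_rpow_atTop hs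
  filter_upwards [eventually_ge_atTop 1, (hpow δ hδ).eventually_ge_atTop x₀,
    (hpow (1 - η) (by linarith)).eventually_ge_atTop x₀, eventually_ge_atTop x₀,
    (hpow η hη0).eventually_ge_atTop (2 / η), tendsto_log_atTop.eventually_ge_atTop (log x₀ / η),
    tendsto_log_atTop.eventually_ge_atTop (4 / δ)]
    with X hX1 hXδ hXη hXx₀ hXη' hlog1 hlog2
  have hX0 : 0 < X := by linarith
  have hlog0 : 0 ≤ log X := log_nonneg hX1
  have hlog1' : log x₀ ≤ η * log X := by rw [div_le_iff₀ hη0] at hlog1; linarith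
  -- Only integers of size above X ^ (1 - η) are kept; they are almost all, and their logarithms are
  -- at least (1 - η) log X.
  have hlower : (1 - 3 * η) * (κ * X * log X) ≤ L X := by
    have h1 : X ^ (1 - η) ≤ X := by
      simpa using rpow_le_rpow_of_exponent_le hX1 (by linarith : 1 - η ≤ 1)
    have h2 := hLge X (X ^ (1 - η)) (hx₀1.trans hXη) h1
    have h3 : X ^ (1 - η) ≤ η / 2 * X := by
      have h4 : X ^ (1 - η) * X ^ η = X := by rw [← rpow_add hX0]; simp
      have h5 : 0 < X ^ (1 - η) := by positivity
      rw [div_le_iff₀ hη0] at hXη'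
      nlinarith
    rw [log_rpow hX0] at h2
    refine le_trans ?_ h2
    have h6 : (1 - 2 * η) * κ * X ≤ A X - A (X ^ (1 - η)) := by
      have h7 := hlow X hXx₀
      have h8 := hup _ hXη
      have h9 : (1 + η) * κ * X ^ (1 - η) ≤ (1 + η) * κ * (η / 2 * X) := by gcongr
      have h10 : (1 + η) * κ * (η / 2 * X) ≤ η * κ * X := by
        have : 0 < η * κ * X := by positivity
        nlinarith
      linarith
    calc (1 - 3 * η) * (κ * X * log X) ≤ ((1 - 2 * η) * (1 - η)) * (κ * X * log X) := by
          gcongr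
          nlinarith
      _ = (1 - 2 * η) * κ * X * ((1 - η) * log X) := by ring
      _ ≤ _ := mul_le_mul_of_nonneg_right h6 (mul_nonneg (by linarith) hlog0)
  -- By Mertens, prime powers up to Y account for only a fraction of about 1 - δ of L X. Those
  -- beyond Y carry the rest, each with a factor A (X / q) of order at most X / Y, so their total
  -- weight is at least Y.
  set Y := X ^ (1 - δ) with hYdef
  have hY1 : 1 ≤ Y := one_le_rpow hX1 (by linarith)
  have hYX : Y ≤ X := by
    simpa using rpow_le_rpow_of_exponent_le hX1 (by linarith : 1 - δ ≤ 1)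
  have hXY : X / Y = X ^ δ := by
    rw [hYdef, rpow_sub hX0, rpow_one]
    field_simp
  have hsmall : ∑ i ∈ S Y, w i * A (X / q i) ≤ (1 - δ + 6 * η) * (κ * X * log X) := by
    have h1 : ∑ i ∈ S Y, w i * A (X / q i) ≤ (1 + η) * κ * X * ∑ i ∈ S Y, w i / q i := by
      rw [Finset.mul_sum]
      refine Finset.sum_le_sum fun i hi => ?_
      have hqi : 0 < q i := zero_lt_one.trans_le (hq i)
      have h2 : x₀ ≤ X / q i := by
        refine (hXδ.trans_eq hXY.symm).trans ?_
        exact div_le_div_of_nonneg_left hX0.le hqi ((hS _ _).1 hi)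
      calc w i * A (X / q i) ≤ w i * ((1 + η) * κ * (X / q i)) :=
            mul_le_mul_of_nonneg_left (hup _ h2) (hw i)
        _ = _ := by ring
    have h2 := hM Y hY1
    rw [hYdef, log_rpow hX0, ← hYdef] at h2
    have h3 : ∑ i ∈ S Y, w i / q i ≤ (1 + 2.5 * η) * ((1 - δ + η) * log X) := by
      have h4 : (1 + η) * ((1 - δ) * log X + log x₀) ≤ (1 + η) * ((1 - δ + η) * log X) := by
        gcongr
        linarith
      have h5 : (1 + η) * ((1 - δ + η) * log X) ≤
          (1 - η) * ((1 + 2.5 * η) * ((1 - δ + η) * log X)) := by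
        have h6 : 0 ≤ (1 - δ + η) * log X := mul_nonneg (by linarith) hlog0
        have h7 : 1 + η ≤ (1 - η) * (1 + 2.5 * η) := by nlinarith
        calc _ ≤ (1 - η) * (1 + 2.5 * η) * ((1 - δ + η) * log X) :=
              mul_le_mul_of_nonneg_right h7 h6
          _ = _ := by ring
      exact le_of_mul_le_mul_left (h2.trans (h4.trans h5)) (by linarith)
    calc _ ≤ (1 + η) * κ * X * ((1 + 2.5 * η) * ((1 - δ + η) * log X)) := h1.trans (by gcongr)
      _ = ((1 + η) * (1 + 2.5 * η) * (1 - δ + η)) * (κ * X * log X) := by ring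
      _ ≤ _ := by
        gcongr
        have : (1 + η) * (1 + 2.5 * η) ≤ 1 + 4 * η := by nlinarith
        calc _ ≤ (1 + 4 * η) * (1 - δ + η) := by gcongr
          _ ≤ _ := by nlinarith
  classical
  have hbig : ∑ i ∈ S X \ S Y, w i * A (X / q i) ≤ (1 + η) * κ * (X / Y) * ∑ i ∈ S X, w i := by
    rw [Finset.mul_sum]
    refine le_trans (Finset.sum_le_sum fun i hi => ?_)
      (Finset.sum_le_sum_of_subset_of_nonneg Finset.sdiff_subset
        fun i _ _ => mul_nonneg (by positivity) (hw i))
    rw [Finset.mem_sdiff, hS, hS, not_le] at hi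
    rw [mul_comm]
    refine mul_le_mul_of_nonneg_right ((hmono ?_).trans (hup _ (hXY ▸ hXδ))) (hw i)
    exact div_le_div_of_nonneg_left hX0.le (by linarith) hi.2.le
  have hsum := Finset.sum_sdiff (f := fun i => w i * A (X / q i)) (hSmono hYX)
  rw [hL, ← hsum] at hlower
  have hfin : (1 + η) * κ * (X / Y) * Y ≤ (1 + η) * κ * (X / Y) * ∑ i ∈ S X, w i := by
    refine le_trans ?_ hbig
    have h1 : (δ - 9 * η) * (κ * X * log X) ≤ ∑ i ∈ S X \ S Y, w i * A (X / q i) := by linarith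
    refine le_trans ?_ h1
    have h2 : X / Y * Y = X := div_mul_cancel₀ _ (by positivity)
    rw [mul_assoc, h2]
    rw [div_le_iff₀ hδ] at hlog2
    have h3 : 0 < κ * X := by positivity
    have h4 : 1 + η ≤ (δ - 9 * η) * log X := by
      rw [hη]
      nlinarith
    calc (1 + η) * κ * X = (1 + η) * (κ * X) := by ring
      _ ≤ ((δ - 9 * η) * log X) * (κ * X) := by gcongr
      _ = _ := by ring
  exact le_of_mul_le_mul_left hfin (by have : 0 < X / Y := by positivity
                                       positivity)

end ChebyshevMertens

/-! ### Counting prime ideals of a number field. -/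

section PrimeIdealCounting

open Real Topology NumberField Ideal IsDedekindDomain
open scoped nonZeroDivisors

variable (K : Type*) [Field K] [NumberField K]

lemma finite_setOf_ne_bot_absNorm_le (x : ℝ) :
    {I : Ideal (𝓞 K) | I ≠ ⊥ ∧ (absNorm I : ℝ) ≤ x}.Finite :=
  (finite_setOfPred_absNorm_le (S := 𝓞 K) ⌊x⌋₊).subset fun _ hI => Nat.le_floor hI.2

/-- The nonzero integral ideals of norm at most `x`. -/
noncomputable def idealsNormLE (x : ℝ) : Finset (Ideal (𝓞 K)) :=
  (finite_setOf_ne_bot_absNorm_le K x).toFinset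

variable {K} in
lemma mem_idealsNormLE {x : ℝ} {I : Ideal (𝓞 K)} :
    I ∈ idealsNormLE K x ↔ I ≠ ⊥ ∧ (absNorm I : ℝ) ≤ x := by
  simp [idealsNormLE]

lemma exists_tendsto_card_idealsNormLE_div :
    ∃ κ : ℝ, 0 < κ ∧ Tendsto (fun x : ℝ => ((idealsNormLE K x).card : ℝ) / x) atTop (𝓝 κ) := by
  refine ⟨_, ?_, (NumberField.Ideal.tendsto_norm_le_div_atTop₀ K).congr fun x => ?_⟩
  · have h1 := Units.regulator_pos K
    have h2 : 0 < classNumber K := Fintype.card_pos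
    have h3 : 0 < Units.torsionOrder K := Units.torsionOrder_pos K
    have h4 : (0 : ℝ) < |(discr K : ℝ)| := abs_pos.2 (by exact_mod_cast discr_ne_zero K)
    have h5 : 0 < √|(discr K : ℝ)| := Real.sqrt_pos.2 h4
    have h6 : (0 : ℝ) < 2 * π := by positivity
    refine div_pos (mul_pos (mul_pos (mul_pos (by positivity) (by positivity)) h1) ?_)
      (mul_pos ?_ ?_)
    · exact_mod_cast h2
    · exact_mod_cast h3
    · exact h5
  · congr 2
    rw [← Nat.card_eq_finsetCard]
    refine Nat.card_congr ((Equiv.subtypeSubtypeEquivSubtypeInter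
      (fun I : Ideal (𝓞 K) => I ∈ (Ideal (𝓞 K))⁰) (fun I => (absNorm I : ℝ) ≤ x)).trans
      (Equiv.subtypeEquivRight fun I => ?_))
    rw [mem_idealsNormLE, mem_nonZeroDivisors_iff_ne_zero, Submodule.zero_eq_bot]

lemma finite_setOf_absNorm_heightOneSpectrum_le (x : ℝ) :
    {v : HeightOneSpectrum (𝓞 K) | (absNorm v.asIdeal : ℝ) ≤ x}.Finite := by
  refine Set.Finite.of_finite_image (f := HeightOneSpectrum.asIdeal) ?_
    (HeightOneSpectrum.asIdeal_injective.injOn)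
  refine (finite_setOf_ne_bot_absNorm_le K x).subset ?_
  rintro _ ⟨v, hv, rfl⟩
  exact ⟨v.ne_bot, hv⟩

/-- The prime ideals of norm at most `x`. -/
noncomputable def primesNormLE (x : ℝ) : Finset (HeightOneSpectrum (𝓞 K)) :=
  (finite_setOf_absNorm_heightOneSpectrum_le K x).toFinset

variable {K} in
lemma mem_primesNormLE {x : ℝ} {v : HeightOneSpectrum (𝓞 K)} :
    v ∈ primesNormLE K x ↔ (absNorm v.asIdeal : ℝ) ≤ x := by
  simp [primesNormLE]

variable {K}

lemma log_absNorm_eq_sum {x : ℝ} {I : Ideal (𝓞 K)} (hI : I ∈ idealsNormLE K x) :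
    log (absNorm I) = ∑ v ∈ primesNormLE K x,
      multiplicity v.asIdeal I * log (absNorm v.asIdeal) := by
  obtain ⟨hI0, hIx⟩ := mem_idealsNormLE.1 hI
  have h1 : ∏ v ∈ primesNormLE K x, v.asIdeal ^ multiplicity v.asIdeal I = I := by
    conv_rhs => rw [← finprod_heightOneSpectrum_pow_multiplicity hI0]
    refine (finprod_eq_prod_of_mulSupport_subset _ fun v hv => ?_).symm
    rw [Function.mem_mulSupport] at hv
    rw [Finset.mem_coe, mem_primesNormLE]
    refine le_trans ?_ hIx
    have h2 : v.asIdeal ∣ I := by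
      by_contra h
      rw [multiplicity_eq_zero.2 h, pow_zero] at hv
      exact hv rfl
    exact_mod_cast Nat.le_of_dvd (Nat.pos_of_ne_zero (absNorm_eq_zero_iff.not.2 hI0))
      (absNorm_dvd_absNorm_of_le (le_of_dvd h2))
  conv_lhs => rw [← h1, map_prod, Nat.cast_prod]
  rw [log_prod]
  · simp
  · intro v _
    have := absNorm_eq_zero_iff.not.2 v.ne_bot
    simp [this]

open Classical in
-- Any range reaching the norm of I suffices: v ^ (k + 1) ∣ I forces k + 1 < N(v) ^ (k + 1) ≤ N(I).
lemma multiplicity_eq_card {I : Ideal (𝓞 K)} (hI : I ≠ ⊥) (v : HeightOneSpectrum (𝓞 K)) {m : ℕ}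
    (hm : absNorm I ≤ m) :
    multiplicity v.asIdeal I =
      ((Finset.range m).filter fun k => v.asIdeal ^ (k + 1) ∣ I).card := by
  have hf : FiniteMultiplicity v.asIdeal I :=
    FiniteMultiplicity.of_not_isUnit v.prime.not_isUnit hI
  have : ((Finset.range m).filter fun k => v.asIdeal ^ (k + 1) ∣ I) =
      Finset.range (multiplicity v.asIdeal I) := by
    ext k
    rw [Finset.mem_filter, Finset.mem_range, Finset.mem_range, hf.pow_dvd_iff_le_multiplicity]
    refine ⟨fun h => h.2, fun h => ⟨?_, h⟩⟩
    have h1 : absNorm (v.asIdeal ^ (k + 1)) ≤ absNorm I :=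
      Nat.le_of_dvd (Nat.pos_of_ne_zero (absNorm_eq_zero_iff.not.2 hI))
        (absNorm_dvd_absNorm_of_le (le_of_dvd (hf.pow_dvd_iff_le_multiplicity.2 h)))
    rw [map_pow] at h1
    have h2 := Nat.lt_pow_self (HeightOneSpectrum.one_lt_absNorm v) (n := k + 1)
    omega
  rw [this, Finset.card_range]

variable (K) in
/-- The prime powers `v ^ (k + 1)` of norm at most `x`, as pairs `(v, k)`. -/
noncomputable def primePowersNormLE (x : ℝ) : Finset (HeightOneSpectrum (𝓞 K) × ℕ) :=
  (primesNormLE K x ×ˢ Finset.range ⌊x⌋₊).filter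
    fun i => (absNorm i.1.asIdeal : ℝ) ^ (i.2 + 1) ≤ x

lemma one_le_absNorm_heightOneSpectrum (v : HeightOneSpectrum (𝓞 K)) :
    (1 : ℝ) ≤ absNorm v.asIdeal := by
  exact_mod_cast (HeightOneSpectrum.one_lt_absNorm v).le

lemma mem_primePowersNormLE {x : ℝ} {i : HeightOneSpectrum (𝓞 K) × ℕ} :
    i ∈ primePowersNormLE K x ↔ (absNorm i.1.asIdeal : ℝ) ^ (i.2 + 1) ≤ x := by
  rw [primePowersNormLE, Finset.mem_filter, Finset.mem_product, mem_primesNormLE, Finset.mem_range]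
  refine ⟨fun h => h.2, fun h => ⟨⟨?_, ?_⟩, h⟩⟩
  · exact (le_self_pow₀ (one_le_absNorm_heightOneSpectrum _) (Nat.succ_ne_zero _)).trans h
  · have h2 := Nat.lt_pow_self (HeightOneSpectrum.one_lt_absNorm i.1) (n := i.2 + 1)
    have h3 : absNorm i.1.asIdeal ^ (i.2 + 1) ≤ ⌊x⌋₊ := Nat.le_floor (by exact_mod_cast h)
    omega

open Classical in
lemma card_filter_dvd_idealsNormLE (x : ℝ) {J : Ideal (𝓞 K)} (hJ : J ≠ ⊥) :
    ((idealsNormLE K x).filter fun I => J ∣ I).card = (idealsNormLE K (x / absNorm J)).card := by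
  have hJ0 : (0 : ℝ) < absNorm J := by
    exact_mod_cast Nat.pos_of_ne_zero (absNorm_eq_zero_iff.not.2 hJ)
  symm
  refine Finset.card_bij (fun I _ => J * I) ?_ ?_ ?_
  · intro I hI
    rw [mem_idealsNormLE] at hI
    rw [Finset.mem_filter, mem_idealsNormLE]
    refine ⟨⟨mul_ne_zero hJ hI.1, ?_⟩, dvd_mul_right _ _⟩
    rw [map_mul, Nat.cast_mul]
    rw [le_div_iff₀ hJ0] at hI
    linarith [hI.2]
  · intro I _ I' _ h
    exact mul_left_cancel₀ hJ h
  · intro I hI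
    rw [Finset.mem_filter, mem_idealsNormLE] at hI
    obtain ⟨⟨hI0, hIx⟩, I', rfl⟩ := hI
    refine ⟨I', mem_idealsNormLE.2 ⟨right_ne_zero_of_mul hI0, ?_⟩, rfl⟩
    rw [map_mul, Nat.cast_mul] at hIx
    rw [le_div_iff₀ hJ0]
    linarith

/-- Legendre's identity: unique factorisation spreads log N(I) over the prime powers dividing I, and
the ideals divisible by J are the J * I'. -/
lemma sum_log_absNorm_eq (x : ℝ) :
    ∑ I ∈ idealsNormLE K x, log (absNorm I) =
      ∑ i ∈ primePowersNormLE K x, log (absNorm i.1.asIdeal) *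
        ((idealsNormLE K (x / (absNorm i.1.asIdeal : ℝ) ^ (i.2 + 1))).card : ℝ) := by
  classical
  have h1 : ∀ I ∈ idealsNormLE K x, log (absNorm I) =
      ∑ i ∈ primePowersNormLE K x,
        if i.1.asIdeal ^ (i.2 + 1) ∣ I then log (absNorm i.1.asIdeal) else 0 := by
    intro I hI
    rw [log_absNorm_eq_sum hI, primePowersNormLE, Finset.sum_filter, Finset.sum_product]
    obtain ⟨hI0, hIx⟩ := mem_idealsNormLE.1 hI
    refine Finset.sum_congr rfl fun v _ => ?_
    rw [multiplicity_eq_card hI0 v (Nat.le_floor hIx), Finset.card_filter, Nat.cast_sum,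
      Finset.sum_mul]
    refine Finset.sum_congr rfl fun k _ => ?_
    by_cases hd : v.asIdeal ^ (k + 1) ∣ I
    · have h2 : absNorm (v.asIdeal ^ (k + 1)) ≤ absNorm I :=
        Nat.le_of_dvd (Nat.pos_of_ne_zero (absNorm_eq_zero_iff.not.2 hI0))
          (absNorm_dvd_absNorm_of_le (le_of_dvd hd))
      have h3 : (absNorm v.asIdeal : ℝ) ^ (k + 1) ≤ x := by
        refine le_trans ?_ hIx
        rw [map_pow] at h2
        exact_mod_cast h2
      simp [hd, h3]
    · simp [hd]
  rw [Finset.sum_congr rfl h1, Finset.sum_comm]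
  refine Finset.sum_congr rfl fun i _ => ?_
  have h2 := card_filter_dvd_idealsNormLE x (J := i.1.asIdeal ^ (i.2 + 1))
    (pow_ne_zero _ i.1.ne_bot)
  rw [map_pow, Nat.cast_pow] at h2
  rw [← h2, ← Finset.sum_filter, Finset.sum_const, nsmul_eq_mul, mul_comm]

/-- A prime of norm q has at most log x / log q powers up to x, each weighted log q, hence
contributes at most log x. -/
lemma sum_log_primePowers_le {x : ℝ} (hx : 1 ≤ x) :
    ∑ i ∈ primePowersNormLE K x, log (absNorm i.1.asIdeal) ≤
      (primesNormLE K x).card * log x := by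
  rw [primePowersNormLE, Finset.sum_filter, Finset.sum_product, ← nsmul_eq_mul]
  refine Finset.sum_le_card_nsmul _ _ _ fun v _ => ?_
  have hv := HeightOneSpectrum.one_lt_absNorm v
  have hv1 : (1 : ℝ) < absNorm v.asIdeal := by exact_mod_cast hv
  have hx0 : 0 < x := by linarith
  dsimp only
  rw [← Finset.sum_filter, Finset.sum_const, nsmul_eq_mul]
  have hsub : (Finset.range ⌊x⌋₊).filter (fun k => (absNorm v.asIdeal : ℝ) ^ (k + 1) ≤ x) ⊆
      Finset.range ⌊log x / log (absNorm v.asIdeal)⌋₊ := by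
    intro k hk
    rw [Finset.mem_filter] at hk
    rw [Finset.mem_range, ← Nat.succ_le_iff]
    refine Nat.le_floor ?_
    rw [le_div_iff₀ (log_pos hv1), ← log_pow]
    exact log_le_log (by positivity) hk.2
  have hcard := Finset.card_le_card hsub
  rw [Finset.card_range] at hcard
  have h1 : (((Finset.range ⌊x⌋₊).filter
      (fun k => (absNorm v.asIdeal : ℝ) ^ (k + 1) ≤ x)).card : ℝ) ≤
      log x / log (absNorm v.asIdeal) :=
    (Nat.cast_le.2 hcard).trans (Nat.floor_le (div_nonneg (log_nonneg hx) (log_pos hv1).le))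
  rwa [le_div_iff₀ (log_pos hv1)] at h1

variable (K) in
/-- A number field has at least `X ^ (1 - δ)` prime ideals of norm at most `X`, for large `X`. -/
theorem eventually_rpow_le_card_primesNormLE {δ : ℝ} (hδ : 0 < δ) :
    ∀ᶠ X : ℝ in atTop, X ^ (1 - δ) ≤ ((primesNormLE K X).card : ℝ) := by
  wlog hδ1 : δ < 1 generalizing δ
  · filter_upwards [this (δ := 1 / 2) (by norm_num) (by norm_num), eventually_ge_atTop 1]
      with X hX hX1
    refine (rpow_le_rpow_of_exponent_le hX1 ?_).trans hX
    linarith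
  obtain ⟨κ, hκ, hA⟩ := exists_tendsto_card_idealsNormLE_div K
  have hmono : ∀ {x y : ℝ}, x ≤ y → idealsNormLE K x ⊆ idealsNormLE K y := fun h I hI =>
    mem_idealsNormLE.2 ⟨(mem_idealsNormLE.1 hI).1, (mem_idealsNormLE.1 hI).2.trans h⟩
  have hpos : ∀ {x : ℝ}, ∀ I ∈ idealsNormLE K x, (1 : ℝ) ≤ absNorm I := fun I hI => by
    exact_mod_cast Nat.pos_of_ne_zero (absNorm_eq_zero_iff.not.2 (mem_idealsNormLE.1 hI).1)
  -- Half of δ is spent here; the other half absorbs the factor log X lost between weighted prime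
  -- powers and primes.
  have h := eventually_rpow_le_sum_vonMangoldt
    (fun i : HeightOneSpectrum (𝓞 K) × ℕ => (absNorm i.1.asIdeal : ℝ) ^ (i.2 + 1))
    (fun i => log (absNorm i.1.asIdeal)) (primePowersNormLE K)
    (fun x => (idealsNormLE K x).card) (fun x => ∑ I ∈ idealsNormLE K x, log (absNorm I))
    (δ := δ / 2) hκ (by positivity) (by linarith) (fun X i => mem_primePowersNormLE)
    (fun i => one_le_pow₀ (one_le_absNorm_heightOneSpectrum _))
    (fun i => log_nonneg (one_le_absNorm_heightOneSpectrum _)) hA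
    (fun x y hxy => Nat.cast_le.2 (Finset.card_le_card (hmono hxy)))
    (fun x => Nat.cast_nonneg _) sum_log_absNorm_eq ?_ ?_
  · have h1 : ∀ᶠ X : ℝ in atTop, log X ≤ X ^ (δ / 2) := by
      filter_upwards [(isLittleO_log_rpow_atTop (by positivity : 0 < δ / 2)).bound one_pos,
        eventually_ge_atTop 1] with X hX hX1
      rw [one_mul, norm_of_nonneg (log_nonneg hX1), norm_of_nonneg (by positivity)] at hX
      exact hX
    filter_upwards [h, h1, eventually_gt_atTop 1] with X hX hX1 hX2
    have h2 := hX.trans (sum_log_primePowers_le hX2.le)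
    have hX0 : 0 < X := by linarith
    have h3 : X ^ (1 - δ) * X ^ (δ / 2) ≤ (primesNormLE K X).card * X ^ (δ / 2) := by
      rw [← rpow_add hX0]
      calc X ^ (1 - δ + δ / 2) = X ^ (1 - δ / 2) := by congr 1; ring
        _ ≤ _ := h2.trans (by gcongr)
    exact le_of_mul_le_mul_right h3 (by positivity)
  · intro X _
    rw [← nsmul_eq_mul]
    refine Finset.sum_le_card_nsmul _ _ _ fun I hI => ?_
    exact log_le_log (by linarith [hpos I hI]) (mem_idealsNormLE.1 hI).2
  · intro X Y hY hYX
    classical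
    rw [← Nat.cast_sub (Finset.card_le_card (hmono hYX)),
      ← Finset.card_sdiff_of_subset (hmono hYX), ← nsmul_eq_mul]
    refine (Finset.card_nsmul_le_sum _ _ _ fun I hI => ?_).trans
      (Finset.sum_le_sum_of_subset_of_nonneg Finset.sdiff_subset
        fun I hI _ => log_nonneg (hpos I hI))
    rw [Finset.mem_sdiff, mem_idealsNormLE, mem_idealsNormLE, not_and, not_le] at hI
    exact log_le_log (by linarith) (hI.2 hI.1.1).le

end PrimeIdealCounting

/-! ### Orbits of polynomial maps over rings. -/

section PolynomialDynamics

/-- The self-map of affine space given by a tuple of polynomials. -/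
noncomputable def polyMap {R : Type*} [CommRing R] {r : ℕ} (F : Fin r → MvPolynomial (Fin r) R) :
    (Fin r → R) → (Fin r → R) := fun x i => MvPolynomial.eval x (F i)

lemma comp_polyMap {R S : Type*} [CommRing R] [CommRing S] (φ : R →+* S) {r : ℕ}
    (F : Fin r → MvPolynomial (Fin r) R) (x : Fin r → R) :
    φ ∘ polyMap F x = polyMap (fun i => MvPolynomial.map φ (F i)) (φ ∘ x) := by
  ext i
  exact MvPolynomial.map_eval φ x (F i)

lemma comp_polyMap_iterate {R S : Type*} [CommRing R] [CommRing S] (φ : R →+* S) {r : ℕ}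
    (F : Fin r → MvPolynomial (Fin r) R) (x : Fin r → R) (n : ℕ) :
    φ ∘ (polyMap F)^[n] x = (polyMap fun i => MvPolynomial.map φ (F i))^[n] (φ ∘ x) := by
  induction n with
  | zero => rfl
  | succ n ih => rw [Function.iterate_succ_apply', comp_polyMap, ih, Function.iterate_succ_apply']

/-- The values of a polynomial along the orbit of a polynomial self-map of affine space. -/
noncomputable def orbitValue {R : Type*} [CommRing R] {r : ℕ} (F : Fin r → MvPolynomial (Fin r) R)
    (G : MvPolynomial (Fin r) R) (x : Fin r → R) (n : ℕ) : R :=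
  MvPolynomial.eval ((polyMap F)^[n] x) G

/-- Used twice: for reduction modulo a place and for descent to a number field. -/
lemma map_orbitValue {R S : Type*} [CommRing R] [CommRing S] (φ : R →+* S) {r : ℕ}
    (F : Fin r → MvPolynomial (Fin r) R) (G : MvPolynomial (Fin r) R) (x : Fin r → R) (n : ℕ) :
    φ (orbitValue F G x n) =
      orbitValue (fun i => MvPolynomial.map φ (F i)) (MvPolynomial.map φ G) (φ ∘ x) n := by
  rw [orbitValue, MvPolynomial.map_eval, comp_polyMap_iterate, orbitValue]

/-- Orbits in the set of points of affine space over a finite ring are preperiodic. -/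
lemma exists_orbitValue_add_eq {R : Type*} [CommRing R] [Finite R] {r : ℕ}
    (F : Fin r → MvPolynomial (Fin r) R) (G : MvPolynomial (Fin r) R) (x : Fin r → R) :
    ∃ m m', m < m' ∧ m' ≤ Nat.card R ^ r ∧
      ∀ k, orbitValue F G x (k + m) = orbitValue F G x (k + m') := by
  have := Fintype.ofFinite R
  classical
  -- Pigeonhole: one more iterate than there are points.
  have hcard : Fintype.card (Fin r → R) < Fintype.card (Fin (Nat.card R ^ r + 1)) := by
    simp
  obtain ⟨i, j, hij, h⟩ := Fintype.exists_ne_map_eq_of_card_lt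
    (fun i : Fin (Nat.card R ^ r + 1) => (polyMap F)^[(i : ℕ)] x) hcard
  have hpre : ∀ m m', (polyMap F)^[m] x = (polyMap F)^[m'] x →
      ∀ k, orbitValue F G x (k + m) = orbitValue F G x (k + m') := by
    intro m m' h k
    rw [orbitValue, orbitValue, Function.iterate_add_apply, h, ← Function.iterate_add_apply]
  rcases lt_or_gt_of_ne (Fin.val_injective.ne hij) with hlt | hlt
  · exact ⟨i, j, hlt, by omega, hpre _ _ h⟩
  · exact ⟨j, i, hlt, by omega, hpre _ _ h.symm⟩

end PolynomialDynamics

/-! ### Residue fields and absolute values at finite places. -/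

section FinitePlaces

open IsDedekindDomain NumberField

/-- Orbit data are integral only at v, so reduction goes through the valuation ring. Elements of R
approximate its elements, so R ⧸ v surjects onto its residue field. -/
lemma residueField_valuationSubring_card_le {R K : Type*} [CommRing R] [IsDedekindDomain R]
    [Field K] [Algebra R K] [IsFractionRing R K] (v : HeightOneSpectrum R) [Finite (R ⧸ v.asIdeal)] :
    Finite (IsLocalRing.ResidueField (v.valuation K).valuationSubring) ∧
      Nat.card (IsLocalRing.ResidueField (v.valuation K).valuationSubring) ≤
        Nat.card (R ⧸ v.asIdeal) := by
  let φ : R →+* (v.valuation K).valuationSubring :=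
    (algebraMap R K).codRestrict _ fun x => v.valuation_le_one x
  let ψ : R →+* IsLocalRing.ResidueField (v.valuation K).valuationSubring :=
    (IsLocalRing.residue _).comp φ
  have hker : ∀ x ∈ v.asIdeal, ψ x = 0 := by
    intro x hx
    refine (IsLocalRing.residue_eq_zero_iff _).2 ?_
    rw [Valuation.mem_maximalIdeal_iff]
    exact (v.valuation_lt_one_iff_mem x).2 hx
  have hsurj : Function.Surjective ψ := by
    intro y
    obtain ⟨⟨x, hx⟩, rfl⟩ := IsLocalRing.residue_surjective y
    obtain ⟨a, ha⟩ := v.exists_valuation_sub_lt_of_integer hx 1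
    refine ⟨a, ?_⟩
    rw [← sub_eq_zero]
    change IsLocalRing.residue _ (φ a) - _ = 0
    rw [← map_sub]
    refine (IsLocalRing.residue_eq_zero_iff _).2 ?_
    rw [Valuation.mem_maximalIdeal_iff]
    simpa using! ha
  have hsurj' : Function.Surjective (Ideal.Quotient.lift v.asIdeal ψ hker) :=
    Ideal.Quotient.lift_surjective_of_surjective _ _ hsurj
  exact ⟨Finite.of_surjective _ hsurj', Nat.card_le_card_of_surjective _ hsurj'⟩

variable {K : Type*} [Field K] [NumberField K]

/-- The norm of the prime ideal attached to a finite place. -/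
noncomputable def FinitePlace.residueCard (v : FinitePlace K) : ℕ :=
  Ideal.absNorm v.maximalIdeal.asIdeal

lemma FinitePlace.one_lt_residueCard (v : FinitePlace K) : 1 < residueCard v :=
  HeightOneSpectrum.one_lt_absNorm _

lemma FinitePlace.apply_eq_toNNReal (v : FinitePlace K) (x : K) :
    v x = WithZeroMulInt.toNNReal (HeightOneSpectrum.absNorm_ne_zero v.maximalIdeal)
      (v.maximalIdeal.valuation K x) := by
  rw [← FinitePlace.norm_embedding_eq, FinitePlace.norm_embedding']

lemma FinitePlace.apply_le_one_iff (v : FinitePlace K) (x : K) :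
    v x ≤ 1 ↔ v.maximalIdeal.valuation K x ≤ 1 := by
  rw [FinitePlace.apply_eq_toNNReal]
  exact_mod_cast WithZeroMulInt.toNNReal_le_one_iff
    (HeightOneSpectrum.one_lt_absNorm_nnreal v.maximalIdeal)

/-- The valuation is discrete and a uniformiser has absolute value 1/q. -/
lemma FinitePlace.apply_le_inv_of_valuation_lt_one (v : FinitePlace K) {x : K}
    (hx : v.maximalIdeal.valuation K x < 1) : v x ≤ (residueCard v : ℝ)⁻¹ := by
  rw [FinitePlace.apply_eq_toNNReal]
  have hq := HeightOneSpectrum.one_lt_absNorm_nnreal v.maximalIdeal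
  by_cases h0 : v.maximalIdeal.valuation K x = 0
  · simp [h0]
  rw [WithZeroMulInt.toNNReal_neg_apply _ h0]
  have hlt : (WithZero.unzero h0).toAdd ≤ -1 := by
    rw [← WithZero.coe_unzero h0, ← WithZero.coe_one, WithZero.coe_lt_coe] at hx
    have : (WithZero.unzero h0).toAdd < 0 := hx
    omega
  have := zpow_le_zpow_right₀ hq.le hlt
  rw [zpow_neg_one] at this
  exact_mod_cast this

end FinitePlaces

/-! ### Hankel determinants at places of good reduction. -/

section GoodReduction

open NumberField

variable {K : Type*} [Field K] [NumberField K] {r : ℕ}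

/-- At a finite place where all data are integral, the values of a polynomial along an orbit are
integral, and preperiodic modulo the place with a preperiod and period bounded by the number of
points of affine space over the residue field. -/
lemma FinitePlace.orbitValue_preperiodic (v : FinitePlace K) (F : Fin r → MvPolynomial (Fin r) K)
    (G : MvPolynomial (Fin r) K) (P : Fin r → K) (hF : ∀ i m, v ((F i).coeff m) ≤ 1)
    (hG : ∀ m, v (G.coeff m) ≤ 1) (hP : ∀ i, v (P i) ≤ 1) :
    (∀ n, v (orbitValue F G P n) ≤ 1) ∧ ∃ m m', m < m' ∧ m' ≤ FinitePlace.residueCard v ^ r ∧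
      ∀ k, v (orbitValue F G P (k + m) - orbitValue F G P (k + m')) ≤
        (FinitePlace.residueCard v : ℝ)⁻¹ := by
  set A := (v.maximalIdeal.valuation K).valuationSubring with hA
  have hmem : ∀ x : K, v x ≤ 1 → x ∈ A := fun x hx => (FinitePlace.apply_le_one_iff v x).1 hx
  have hlift : ∀ H : MvPolynomial (Fin r) K, (∀ m, v (H.coeff m) ≤ 1) →
      ∃ H' : MvPolynomial (Fin r) A, MvPolynomial.map A.subtype H' = H := by
    intro H hH
    have : H ∈ Set.range (MvPolynomial.map (σ := Fin r) A.subtype) := by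
      refine MvPolynomial.mem_range_map_iff_coeffs_subset.2 fun c hc => ?_
      obtain ⟨m, _, rfl⟩ := MvPolynomial.mem_coeffs_iff.1 hc
      exact ⟨⟨_, hmem _ (hH m)⟩, rfl⟩
    exact this
  choose F' hF' using fun i => hlift (F i) (hF i)
  obtain ⟨G', hG'⟩ := hlift G hG
  let P' : Fin r → A := fun i => ⟨P i, hmem _ (hP i)⟩
  have hval : ∀ n, orbitValue F G P n = (orbitValue F' G' P' n : A) := by
    intro n
    have := map_orbitValue A.subtype F' G' P' n
    rw [hG'] at this
    simp_rw [hF'] at this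
    exact this.symm
  refine ⟨fun n => ?_, ?_⟩
  · rw [hval, FinitePlace.apply_le_one_iff]
    exact (orbitValue F' G' P' n).2
  · have hfin : Finite (𝓞 K ⧸ v.maximalIdeal.asIdeal) :=
      v.maximalIdeal.asIdeal.finiteQuotientOfFreeOfNeBot v.maximalIdeal.ne_bot
    obtain ⟨hfin', hcard⟩ := residueField_valuationSubring_card_le (K := K) v.maximalIdeal
    let φ : A →+* IsLocalRing.ResidueField A := IsLocalRing.residue A
    obtain ⟨m, m', hlt, hle, h⟩ := exists_orbitValue_add_eq (fun i => MvPolynomial.map φ (F' i))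
      (MvPolynomial.map φ G') (φ ∘ P')
    refine ⟨m, m', hlt, hle.trans (Nat.pow_le_pow_left hcard r), fun k => ?_⟩
    rw [hval, hval]
    refine FinitePlace.apply_le_inv_of_valuation_lt_one v ?_
    have h1 := h k
    rw [← map_orbitValue, ← map_orbitValue, ← sub_eq_zero, ← map_sub] at h1
    exact ((v.maximalIdeal.valuation K).mem_maximalIdeal_iff).1 ((IsLocalRing.residue_eq_zero_iff _).1 h1)

/-- Ultrametric bound for a determinant from bounds on its columns. -/
lemma IsNonarchimedean.apply_det_le {K : Type*} [CommRing K] [Nontrivial K] {v : AbsoluteValue K ℝ}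
    (hv : IsNonarchimedean v) {n : Type*} [Fintype n] [DecidableEq n] (B : Matrix n n K)
    (w : n → ℝ) (h : ∀ i j, v (B i j) ≤ w j) : v B.det ≤ ∏ j, w j := by
  rw [Matrix.det_apply]
  obtain ⟨σ, _, hσ⟩ := hv.finset_image_add_of_nonempty
    (fun σ : Equiv.Perm n => Equiv.Perm.sign σ • ∏ i, B (σ i) i) Finset.univ_nonempty
  refine hσ.trans ?_
  rw [v.map_units_int_smul, map_prod]
  exact Finset.prod_le_prod (fun i _ => v.nonneg _) fun i _ => h _ _

/-- Subtracting from each column `j ≥ m'` of a Hankel matrix the column `j - (m' - m)` does not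
change its determinant. -/
lemma IsNonarchimedean.apply_det_hankel_le {K : Type*} [Field K] {v : AbsoluteValue K ℝ}
    (hv : IsNonarchimedean v) (a : ℕ → K) {m m' : ℕ} (hm : m < m') {ε : ℝ}
    (ha : ∀ n, v (a n) ≤ 1) (h : ∀ k, v (a (k + m) - a (k + m')) ≤ ε) (N : ℕ) :
    v (hankel a N).det ≤ ε ^ (N - m') := by
  -- Right multiplication by the unipotent U does all the column subtractions at once, always with
  -- the original columns.
  let U : Matrix (Fin N) (Fin N) K := Matrix.of fun i j =>
    if i = j then 1 else if (m' ≤ j ∧ (i : ℕ) + (m' - m) = j) then -1 else 0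
  have hU : U.det = 1 := by
    rw [Matrix.det_of_isUpperTriangular]
    · simp [U]
    · intro i j hij
      have h1 : (j : ℕ) < i := hij
      have h2 : i ≠ j := by rintro rfl; exact lt_irrefl _ h1
      have h3 : ¬ (m' ≤ (j : ℕ) ∧ (i : ℕ) + (m' - m) = j) := by omega
      simp [U, h2, h3]
  have hprod : ∀ i j, (hankel a N * U) i j =
      if m' ≤ (j : ℕ) then a (i + j) - a (i + (j - (m' - m))) else a (i + j) := by
    intro i j
    rw [Matrix.mul_apply]
    split_ifs with hj
    · have hj' : (j : ℕ) - (m' - m) < N := by omega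
      have hne : (⟨(j : ℕ) - (m' - m), hj'⟩ : Fin N) ≠ j := by
        intro h1
        have := congrArg Fin.val h1
        simp only at this
        omega
      rw [← Finset.sum_subset (Finset.subset_univ {j, ⟨(j : ℕ) - (m' - m), hj'⟩}),
        Finset.sum_pair hne.symm]
      · have h3 : (j : ℕ) - (m' - m) + (m' - m) = j := by omega
        simp [U, hne, hankel_apply, hj, h3, sub_eq_add_neg]
      · intro k _ hk
        simp only [Finset.mem_insert, Finset.mem_singleton, not_or] at hk
        have h4 : ¬ (m' ≤ (j : ℕ) ∧ (k : ℕ) + (m' - m) = j) := by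
          rintro ⟨_, h5⟩
          exact hk.2 (Fin.ext (by simp only; omega))
        simp [U, hk.1, h4]
    · rw [Finset.sum_eq_single j]
      · simp [U, hankel_apply]
      · intro k _ hk
        simp [U, hk, hj]
      · simp
  have hdet : (hankel a N).det = (hankel a N * U).det := by rw [Matrix.det_mul, hU, mul_one]
  rw [hdet]
  refine (hv.apply_det_le _ (fun j : Fin N => if m' ≤ (j : ℕ) then ε else 1) fun i j => ?_).trans ?_
  · rw [hprod]
    split_ifs with hj
    · obtain ⟨k, hk⟩ := Nat.exists_eq_add_of_le hj
      have h1 := h (i + k)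
      rw [v.map_sub] at h1
      rwa [show (i : ℕ) + j = i + k + m' by omega,
        show (i : ℕ) + (j - (m' - m)) = i + k + m by omega]
    · exact ha _
  -- The exponent counts the columns j ≥ m'; truncated subtraction makes it 0 when m' ≥ N.
  · rw [Finset.prod_ite, Finset.prod_const_one, mul_one, Finset.prod_const]
    have : (Finset.univ.filter fun j : Fin N => m' ≤ (j : ℕ)).card = N - m' := by
      have h1 := Fin.card_filter_val_lt (n := N) (m := m')
      have h2 := Finset.card_filter_add_card_filter_not (s := (Finset.univ : Finset (Fin N)))
        (fun j : Fin N => (j : ℕ) < m')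
      simp only [not_lt, Finset.card_univ, Fintype.card_fin] at h2
      omega
    rw [this]

end GoodReduction

/-! ### Vanishing of Hankel determinants by the product formula. -/

section HankelVanishing

open NumberField Height Real

variable {K : Type*} [Field K] [NumberField K] {r : ℕ}

lemma NumberField.FinitePlace.finite_one_lt (x : K) : {v : FinitePlace K | 1 < v x}.Finite := by
  by_cases hx : x = 0
  · convert Set.finite_empty
    ext v
    simp [hx, map_zero, zero_le_one]
  · refine (FinitePlace.hasFiniteMulSupport hx).subset fun v hv => ?_
    exact (show 1 < v x from hv).ne'

lemma le_exp_posLog {y : ℝ} (hy : 0 ≤ y) : y ≤ exp (log⁺ y) := by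
  rcases hy.eq_or_lt with rfl | hy
  · positivity
  · calc y = exp (log y) := (exp_log hy).symm
      _ ≤ _ := exp_le_exp.2 (le_max_right _ _)

/-- `logHeight₁` is the height relative to K, a sum of nonnegative local terms, so it dominates each
term without a degree factor. -/
lemma NumberField.FinitePlace.apply_le_exp_logHeight₁ (v : FinitePlace K) (x : K) :
    v x ≤ exp (logHeight₁ x) := by
  refine (le_exp_posLog (apply_nonneg v x)).trans (exp_le_exp.2 ?_)
  rw [NumberField.logHeight₁_eq]
  have hfin : (Function.support fun v : FinitePlace K => log⁺ (v x)).Finite := by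
    refine (FinitePlace.finite_one_lt x).subset fun w hw => ?_
    by_contra h
    refine hw (posLog_eq_zero_iff _ |>.2 ?_)
    rw [abs_of_nonneg (apply_nonneg w x)]
    exact not_lt.1 h
  have h1 := single_le_finsum v hfin fun _ => posLog_nonneg
  have h2 : 0 ≤ ∑ w : InfinitePlace K, w.mult * log⁺ (w x) :=
    Finset.sum_nonneg fun w _ => mul_nonneg (Nat.cast_nonneg _) posLog_nonneg
  linarith

lemma NumberField.InfinitePlace.apply_le_exp_logHeight₁ (w : InfinitePlace K) (x : K) :
    w x ≤ exp (logHeight₁ x) := by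
  refine (le_exp_posLog (apply_nonneg w x)).trans (exp_le_exp.2 ?_)
  rw [NumberField.logHeight₁_eq]
  have h1 := Finset.single_le_sum
    (fun (w : InfinitePlace K) _ => mul_nonneg (Nat.cast_nonneg w.mult) (posLog_nonneg (x := w x)))
    (Finset.mem_univ w)
  have h2 : 0 ≤ ∑ᶠ v : FinitePlace K, log⁺ (v x) := finsum_nonneg fun _ => posLog_nonneg
  have h3 : log⁺ (w x) ≤ w.mult * log⁺ (w x) :=
    le_mul_of_one_le_left posLog_nonneg (by exact_mod_cast w.mult_pos)
  linarith

/-- The product formula as an inequality: `B₁` bounds the archimedean absolute values of `x`, `B₂`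
bounds those at a finite set `S` of finite places outside which `x` is integral, and `g` bounds
those at a finite set `T` of finite places. -/
lemma NumberField.one_le_of_forall_place_le {x : K} (hx : x ≠ 0) {B₁ B₂ g : ℝ}
    (S T : Finset (FinitePlace K)) (hST : Disjoint S T)
    (h₁ : ∀ w : InfinitePlace K, w x ≤ B₁) (h₂ : ∀ v ∈ S, v x ≤ B₂)
    (h₃ : ∀ v ∉ S, v x ≤ 1) (h₄ : ∀ v ∈ T, v x ≤ g) :
    1 ≤ B₁ ^ totalWeight K * (B₂ ^ S.card * g ^ T.card) := by
  classical
  have hprod := prod_abs_eq_one hx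
  have hinf : ∏ w : InfinitePlace K, w x ^ w.mult ≤ B₁ ^ totalWeight K := by
    rw [totalWeight_eq_sum_mult, ← Finset.prod_pow_eq_pow_sum]
    exact Finset.prod_le_prod (fun w _ => pow_nonneg (apply_nonneg w x) _)
      fun w _ => pow_le_pow_left₀ (apply_nonneg w x) (h₁ w) _
  have hfin : ∏ᶠ v : FinitePlace K, v x ≤ B₂ ^ S.card * g ^ T.card := by
    have hsupp := FinitePlace.hasFiniteMulSupport hx
    rw [finprod_eq_prod_of_mulSupport_subset (s := hsupp.toFinset ∪ (S ∪ T)) _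
      (fun v hv => Finset.mem_coe.2 (Finset.mem_union_left _ (hsupp.mem_toFinset.2 hv)))]
    calc _ ≤ ∏ v ∈ hsupp.toFinset ∪ (S ∪ T),
          (if v ∈ S then B₂ else 1) * (if v ∈ T then g else 1) := by
          refine Finset.prod_le_prod (fun v _ => apply_nonneg v x) fun v _ => ?_
          by_cases hS : v ∈ S
          · simpa [hS, Finset.disjoint_left.1 hST hS] using h₂ v hS
          · by_cases hT : v ∈ T
            · simpa [hS, hT] using h₄ v hT
            · simpa [hS, hT] using h₃ v hS
      _ = _ := by
          rw [Finset.prod_mul_distrib, Finset.prod_ite_mem, Finset.prod_ite_mem,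
            Finset.inter_eq_right.2, Finset.inter_eq_right.2, Finset.prod_const,
            Finset.prod_const]
          · exact Finset.subset_union_right.trans Finset.subset_union_right
          · exact Finset.subset_union_left.trans Finset.subset_union_right
  rw [← hprod]
  refine mul_le_mul hinf hfin (finprod_nonneg fun v => apply_nonneg v x) ?_
  exact (Finset.prod_nonneg fun w _ => pow_nonneg (apply_nonneg w x) _).trans hinf

variable (F : Fin r → MvPolynomial (Fin r) K) (G : MvPolynomial (Fin r) K) (P : Fin r → K)

/-- Finitely many coefficients and coordinates occur, each non-integral at finitely many places; S
holds the places of bad reduction. -/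
lemma exists_finset_integral_data : ∃ S : Finset (FinitePlace K), ∀ v ∉ S,
    (∀ i m, v ((F i).coeff m) ≤ 1) ∧ (∀ m, v (G.coeff m) ≤ 1) ∧ ∀ i, v (P i) ≤ 1 := by
  classical
  let T : Finset K := (Finset.univ.biUnion fun i => (F i).coeffs) ∪ G.coeffs ∪
    Finset.univ.image P
  have hT : {v : FinitePlace K | ∃ x ∈ T, 1 < v x}.Finite := by
    have : {v : FinitePlace K | ∃ x ∈ T, 1 < v x} = ⋃ x ∈ T, {v : FinitePlace K | 1 < v x} := by
      ext; simp
    rw [this]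
    exact T.finite_toSet.biUnion fun x _ => FinitePlace.finite_one_lt x
  have hcoeff : ∀ (H : MvPolynomial (Fin r) K) (v : FinitePlace K), (∀ x ∈ H.coeffs, v x ≤ 1) →
      ∀ m, v (H.coeff m) ≤ 1 := by
    intro H v h m
    by_cases hm : H.coeff m = 0
    · rw [hm, map_zero]
      exact zero_le_one
    · exact h _ (MvPolynomial.coeff_mem_coeffs m hm)
  refine ⟨hT.toFinset, fun v hv => ?_⟩
  have hv' : ∀ x ∈ T, v x ≤ 1 := by
    intro x hx
    by_contra h
    exact hv (hT.mem_toFinset.2 ⟨x, hx, not_le.1 h⟩)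
  refine ⟨fun i => hcoeff _ v fun x hx => hv' x ?_, hcoeff _ v fun x hx => hv' x ?_,
    fun i => hv' _ ?_⟩
  · simp only [T, Finset.mem_union, Finset.mem_biUnion]
    exact Or.inl (Or.inl ⟨i, Finset.mem_univ _, hx⟩)
  · simp only [T, Finset.mem_union]
    exact Or.inl (Or.inr hx)
  · simp [T]

/-- If the heights along an orbit in affine `r`-space grow slower than `n ^ c` with `c < 1 / r`, then
the Hankel determinants of the sequence of values eventually vanish. -/
theorem exists_forall_det_hankel_orbitValue_eq_zero (hr : 0 < r) {c C : ℝ} (hc0 : 0 < c)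
    (hc : c < 1 / r) (h : ∀ n : ℕ, logHeight₁ (orbitValue F G P n) ≤ C * ((n : ℝ) + 1) ^ c) :
    ∃ N₀, ∀ N ≥ N₀, (hankel (orbitValue F G P) N).det = 0 := by
  classical
  have hr0 : (0 : ℝ) < r := by exact_mod_cast hr
  have hC : 0 ≤ C := by
    have h1 := (zero_le_logHeight₁ _).trans (h 0)
    simpa using h1
  obtain ⟨S, hS⟩ := exists_finset_integral_data F G P
  -- With δ = 1 - c' * r and X = (N / 2) ^ (1 / r), the prime count X ^ (1 - δ) is (N / 2) ^ c',
  -- which outgrows N ^ c.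
  obtain ⟨c', hcc', hc'⟩ := exists_between hc
  have hδ : 0 < 1 - c' * r := by
    rw [lt_div_iff₀ hr0] at hc'
    linarith
  have hprimes := eventually_rpow_le_card_primesNormLE K hδ
  obtain ⟨D, hD⟩ : ∃ D : ℝ, D = totalWeight K := ⟨_, rfl⟩
  obtain ⟨s, hs⟩ : ∃ s : ℝ, s = S.card := ⟨_, rfl⟩
  have hD0 : 0 ≤ D := hD ▸ Nat.cast_nonneg _
  have hs0 : 0 ≤ s := hs ▸ Nat.cast_nonneg _
  -- D / c comes from log N! ≤ N * N ^ c / c at the archimedean places, D + s from the entry bounds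
  -- there and at the bad places.
  obtain ⟨E, hE⟩ : ∃ E, E = D / c + (D + s) * (C * 2 ^ c) := ⟨_, rfl⟩
  have hlim : Tendsto (fun N : ℕ => ((N : ℝ) / 2) ^ (1 / (r : ℝ))) atTop atTop :=
    (tendsto_rpow_atTop (by positivity)).comp
      (tendsto_natCast_atTop_atTop.atTop_div_const two_pos)
  have hlim2 : Tendsto (fun N : ℕ => (N : ℝ) ^ (c' - c)) atTop atTop :=
    (tendsto_rpow_atTop (by linarith)).comp tendsto_natCast_atTop_atTop
  have hlog2 : 0 < log 2 := log_pos one_lt_two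
  refine eventually_atTop.1 ?_
  filter_upwards [hlim.eventually hprimes, eventually_ge_atTop 1,
    hlim2.eventually_ge_atTop ((E + s + 1) * 2 ^ c' * 2 / log 2)] with N hN hN1 hN2
  by_contra hdet
  set a := orbitValue F G P with ha
  set X : ℝ := ((N : ℝ) / 2) ^ (1 / (r : ℝ)) with hX
  have hNr : (1 : ℝ) ≤ N := by exact_mod_cast hN1
  have hN0 : (0 : ℝ) < N := by linarith
  have hX' : X ^ (1 - (1 - c' * r)) = ((N : ℝ) / 2) ^ c' := by
    rw [hX, ← rpow_mul (by positivity)]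
    congr 1
    field_simp
    ring
  rw [hX'] at hN
  set b : ℝ := exp (C * (2 * N) ^ c) with hb
  have hab : ∀ i j : Fin N, logHeight₁ (hankel a N i j) ≤ C * (2 * N) ^ c := by
    intro i j
    refine (h _).trans ?_
    gcongr
    have h1 : ((i + j : ℕ) : ℝ) + 1 ≤ 2 * N := by
      have : (i : ℕ) + j + 1 ≤ 2 * N := by omega
      exact_mod_cast this
    exact h1
  let T : Finset (FinitePlace K) :=
    (primesNormLE K X).map FinitePlace.equivHeightOneSpectrum.symm.toEmbedding \ S
  have hTcard : ((N : ℝ) / 2) ^ c' - s ≤ T.card := by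
    have h1 := Finset.le_card_sdiff S
      ((primesNormLE K X).map FinitePlace.equivHeightOneSpectrum.symm.toEmbedding)
    rw [Finset.card_map] at h1
    change _ ≤ T.card at h1
    have h2 : (primesNormLE K X).card ≤ T.card + S.card := by omega
    have h3 : ((primesNormLE K X).card : ℝ) ≤ T.card + s := by rw [hs]; exact_mod_cast h2
    linarith
  have hna : ∀ v : FinitePlace K, IsNonarchimedean v.val := fun v => FinitePlace.add_le v
  have hmain := one_le_of_forall_place_le hdet S T Finset.disjoint_sdiff
    (B₁ := N.factorial * b ^ N) (B₂ := b ^ N) (g := (2 : ℝ) ^ (-((N : ℝ) / 2))) ?_ ?_ ?_ ?_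
  · have hb1 : 0 < b := exp_pos _
    have hf0 : (0 : ℝ) < N.factorial := by exact_mod_cast N.factorial_pos
    have h1 := log_nonneg hmain
    rw [log_mul (by positivity) (by positivity), log_mul (by positivity) (by positivity), log_pow,
      log_pow, log_pow, log_mul (by positivity) (by positivity), log_pow, log_pow, log_rpow two_pos, hb,
      log_exp, ← hD, ← hs] at h1
    have h2 : log N.factorial ≤ N * ((N : ℝ) ^ c / c) := by
      calc log N.factorial ≤ log ((N : ℝ) ^ N) := by
            refine log_le_log hf0 ?_
            exact_mod_cast Nat.factorial_le_pow N
        _ = N * log N := log_pow _ _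
        _ ≤ _ := by gcongr; exact log_le_rpow_div hN0.le hc0
    have h3 : (2 * (N : ℝ)) ^ c = 2 ^ c * (N : ℝ) ^ c := mul_rpow two_pos.le hN0.le
    rw [h3] at h1
    have h4 : (N : ℝ) * (T.card * (log 2 / 2)) ≤ N * (E * (N : ℝ) ^ c) := by
      have h5 : D * (log N.factorial) ≤ D * (N * ((N : ℝ) ^ c / c)) := by gcongr
      have h6 : (N : ℝ) * (E * (N : ℝ) ^ c) = D * (N * ((N : ℝ) ^ c / c)) +
          (D * (N * (C * (2 ^ c * (N : ℝ) ^ c))) + s * (N * (C * (2 ^ c * (N : ℝ) ^ c)))) := by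
        rw [hE]
        ring
      rw [h6]
      linarith
    have h7 : T.card * (log 2 / 2) ≤ E * (N : ℝ) ^ c := le_of_mul_le_mul_left h4 hN0
    have h8 : (((N : ℝ) / 2) ^ c' - s) * (log 2 / 2) ≤ E * (N : ℝ) ^ c :=
      (mul_le_mul_of_nonneg_right hTcard (by positivity)).trans h7
    have h9 : (1 : ℝ) ≤ (N : ℝ) ^ c := one_le_rpow hNr hc0.le
    have h10 : ((N : ℝ) / 2) ^ c' = (N : ℝ) ^ (c' - c) * (N : ℝ) ^ c / 2 ^ c' := by
      rw [div_rpow hN0.le two_pos.le, ← rpow_add hN0, sub_add_cancel]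
    have h11 : (E + s + 1) * (N : ℝ) ^ c ≤ ((N : ℝ) / 2) ^ c' * (log 2 / 2) := by
      rw [h10]
      have h12 : (0 : ℝ) < 2 ^ c' := by positivity
      rw [div_le_iff₀ hlog2] at hN2
      have h13 : (E + s + 1) ≤ (N : ℝ) ^ (c' - c) * log 2 / (2 ^ c' * 2) := by
        rw [le_div_iff₀ (by positivity)]
        linarith
      calc _ ≤ (N : ℝ) ^ (c' - c) * log 2 / (2 ^ c' * 2) * (N : ℝ) ^ c := by gcongr
        _ = _ := by
          field_simp
    have h14 : log 2 < 1 := log_two_lt_d9.trans (by norm_num)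
    nlinarith
  · intro w
    have h1 := Matrix.det_le (A := hankel a N) (abv := w.val) (x := b) fun i j =>
      (InfinitePlace.apply_le_exp_logHeight₁ w _).trans (exp_le_exp.2 (hab i j))
    change w.val _ ≤ _
    simpa using h1
  · intro v _
    have h1 := (hna v).apply_det_le (hankel a N) (fun _ => b) fun i j =>
      (FinitePlace.apply_le_exp_logHeight₁ v _).trans (exp_le_exp.2 (hab i j))
    change v.val _ ≤ _
    simpa using h1
  · intro v hv
    obtain ⟨hF, hG, hP⟩ := hS v hv
    have h1 := (hna v).apply_det_le (hankel a N) (fun _ => 1) fun i j =>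
      (FinitePlace.orbitValue_preperiodic v F G P hF hG hP).1 _
    change v.val _ ≤ _
    simpa using h1
  · intro v hv
    rw [Finset.mem_sdiff, Finset.mem_map_equiv, Equiv.symm_symm, mem_primesNormLE] at hv
    obtain ⟨hF, hG, hP⟩ := hS v hv.2
    obtain ⟨hint, m, m', hlt, hle, hmod⟩ := FinitePlace.orbitValue_preperiodic v F G P hF hG hP
    have h1 := (hna v).apply_det_hankel_le a hlt hint hmod N
    refine h1.trans ?_
    have hq : (2 : ℝ) ≤ FinitePlace.residueCard v := by
      exact_mod_cast FinitePlace.one_lt_residueCard v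
    have hqX : (FinitePlace.residueCard v : ℝ) ≤ X := hv.1
    -- This is what X was chosen for: q ≤ X gives q ^ r ≤ N / 2, leaving at least N / 2 small
    -- columns.
    have hm' : (m' : ℝ) ≤ N / 2 := by
      calc (m' : ℝ) ≤ (FinitePlace.residueCard v : ℝ) ^ r := by exact_mod_cast hle
        _ ≤ X ^ r := by gcongr
        _ = N / 2 := by
          rw [hX, ← rpow_natCast, ← rpow_mul (by positivity)]
          rw [one_div_mul_cancel hr0.ne', rpow_one]
    have hm'N : m' ≤ N := by
      have : (m' : ℝ) ≤ N := by linarith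
      exact_mod_cast this
    calc ((FinitePlace.residueCard v : ℝ)⁻¹) ^ (N - m') ≤ ((2 : ℝ)⁻¹) ^ (N - m') := by
          gcongr
      _ = (2 : ℝ) ^ (-((N - m' : ℕ) : ℝ)) := by
          rw [rpow_neg two_pos.le, rpow_natCast, inv_pow]
      _ ≤ _ := by
          refine rpow_le_rpow_of_exponent_le one_le_two ?_
          rw [Nat.cast_sub hm'N]
          linarith

end HankelVanishing

/-! ### Relative and absolute heights; roots of unity. -/

section AbsoluteHeight

open NumberField Height Real

variable {K : Type*} [Field K] [NumberField K]

lemma NumberField.logHeight₁_le_of_isIntegral {x : K} (hx : IsIntegral ℤ x) {B : ℝ} (hB : 0 ≤ B)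
    (h : ∀ w : InfinitePlace K, w x ≤ exp B) : logHeight₁ x ≤ Module.finrank ℚ K * B := by
  rw [NumberField.logHeight₁_eq]
  have h1 : ∑ᶠ v : FinitePlace K, log⁺ (v x) = 0 := by
    refine finsum_eq_zero_of_forall_eq_zero fun v => (posLog_eq_zero_iff _).2 ?_
    rw [abs_of_nonneg (apply_nonneg v x), ← FinitePlace.norm_embedding_eq]
    exact FinitePlace.norm_le_one K v.maximalIdeal (⟨x, hx⟩ : 𝓞 K)
  rw [h1, add_zero, ← InfinitePlace.sum_mult_eq, Nat.cast_sum, Finset.sum_mul]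
  refine Finset.sum_le_sum fun w _ => mul_le_mul_of_nonneg_left ?_ (Nat.cast_nonneg _)
  refine max_le hB ?_
  rcases (apply_nonneg w x).eq_or_lt with h0 | h0
  · rw [← h0, log_zero]
    exact hB
  · exact (log_le_log h0 (h w)).trans_eq (log_exp B)

/-- A crude comparison of the height relative to a number field with the absolute height. -/
lemma NumberField.logHeight₁_le_absLogHeight₁ {L : Type*} [Field L] [CharZero L] (i : K →+* L)
    (y : K) : logHeight₁ y ≤ 3 * (Module.finrank ℚ K : ℝ) ^ 2 * absLogHeight₁ (i y) := by
  have hiq : Algebra.IsIntegral ℚ K := inferInstance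
  let j : K →ₐ[ℚ] L := i.toRatAlgHom
  have hyi : IsIntegral ℚ y := hiq.isIntegral y
  have hx : IsIntegral ℚ (i y) := hyi.map j
  have : FiniteDimensional ℚ (IntermediateField.adjoin ℚ {i y}) :=
    IntermediateField.adjoin.finiteDimensional hx
  have : NumberField (IntermediateField.adjoin ℚ {i y}) := {}
  set g := IntermediateField.AdjoinSimple.gen ℚ (i y) with hg
  have hgx : algebraMap _ L g = i y := IntermediateField.AdjoinSimple.algebraMap_gen ℚ (i y)
  have habs : absLogHeight₁ (i y) =
      (Module.finrank ℚ (IntermediateField.adjoin ℚ {i y}) : ℝ)⁻¹ * logHeight₁ g := by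
    rw [absLogHeight₁, absMulHeight₁, dif_pos hx, log_rpow (mulHeight₁_pos _)]
    rfl
  have hmin : minpoly ℚ (i y) = minpoly ℚ y := minpoly.algHom_eq j i.injective y
  have hfr : Module.finrank ℚ (IntermediateField.adjoin ℚ {i y}) ≤ Module.finrank ℚ K := by
    rw [IntermediateField.adjoin.finrank hx, hmin]
    exact minpoly.natDegree_le y
  have hfr0 : 0 < Module.finrank ℚ (IntermediateField.adjoin ℚ {i y}) := Module.finrank_pos
  set h := logHeight₁ g with hh
  have hh0 : 0 ≤ h := zero_le_logHeight₁ g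
  -- A denominator n bounded by the height of g reduces everything to the integral elements n * y
  -- and n, whose heights are purely archimedean; no places of K need be matched with places of the
  -- subfield.
  obtain ⟨n, hn0, hnle, hnint⟩ := exists_nat_le_mulHeight₁ g
  have hnpos : (0 : ℝ) < n := by exact_mod_cast Nat.pos_of_ne_zero hn0
  have hnexp : (n : ℝ) ≤ exp h := by
    rw [hh, logHeight₁_eq_log_mulHeight₁, exp_log (mulHeight₁_pos _)]
    exact hnle
  have hnK : (n : K) ≠ 0 := by exact_mod_cast hn0
  have hint : IsIntegral ℤ ((n : K) * y) := by
    have h1 := hnint.map (algebraMap (IntermediateField.adjoin ℚ {i y}) L).toIntAlgHom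
    have h2 : (algebraMap (IntermediateField.adjoin ℚ {i y}) L).toIntAlgHom (n * g) =
        i.toIntAlgHom (n * y) := by
      change algebraMap _ L (n * g) = i (n * y)
      rw [map_mul, map_mul, hgx, map_natCast, map_natCast]
    rw [h2] at h1
    exact (isIntegral_algHom_iff i.toIntAlgHom i.injective).1 h1
  -- An embedding of K sends y to a conjugate of g, that is, to the image of g under an embedding of
  -- the subfield.
  have hw : ∀ w : InfinitePlace K, w y ≤ exp h := by
    intro w
    have hroot : w.embedding y ∈ (minpoly ℚ (i y)).aroots ℂ := by
      rw [Polynomial.mem_aroots, hmin]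
      refine ⟨minpoly.ne_zero hyi, ?_⟩
      have := Polynomial.aeval_algHom_apply w.embedding.toRatAlgHom y (minpoly ℚ y)
      rw [minpoly.aeval, map_zero] at this
      exact this
    let ψ := (IntermediateField.algHomAdjoinIntegralEquiv ℚ hx).symm ⟨_, hroot⟩
    have hψ : ψ g = w.embedding y :=
      IntermediateField.algHomAdjoinIntegralEquiv_symm_apply_gen ℚ hx ⟨_, hroot⟩
    have h1 := InfinitePlace.apply_le_exp_logHeight₁ (InfinitePlace.mk ψ.toRingHom) g
    rw [InfinitePlace.apply] at h1
    rw [← InfinitePlace.norm_embedding_eq, ← hψ]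
    exact h1
  have hwn : ∀ w : InfinitePlace K, w (n : K) = n := by
    intro w
    rw [← InfinitePlace.norm_embedding_eq, map_natCast, Complex.norm_natCast]
  have h1 : logHeight₁ ((n : K) * y) ≤ Module.finrank ℚ K * (2 * h) := by
    refine logHeight₁_le_of_isIntegral hint (by positivity) fun w => ?_
    rw [map_mul, hwn, two_mul, exp_add]
    exact mul_le_mul hnexp (hw w) (apply_nonneg w y) (exp_pos _).le
  have h2 : logHeight₁ (n : K) ≤ Module.finrank ℚ K * h :=
    logHeight₁_le_of_isIntegral (by simpa using isIntegral_algebraMap (R := ℤ) (A := K) (x := (n : ℤ)))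
      hh0 fun w => (hwn w).trans_le hnexp
  have h3 : logHeight₁ y ≤ Module.finrank ℚ K * (3 * h) := by
    have h4 := logHeight₁_mul_le ((n : K) * y) (n : K)⁻¹
    rw [logHeight₁_inv, mul_right_comm, mul_inv_cancel₀ hnK, one_mul] at h4
    linarith
  have h5 : h = Module.finrank ℚ (IntermediateField.adjoin ℚ {i y}) * absLogHeight₁ (i y) := by
    rw [habs, mul_inv_cancel_left₀ (by positivity)]
  have h6 : 0 ≤ absLogHeight₁ (i y) := by
    rw [habs]
    positivity
  have h7 : h ≤ Module.finrank ℚ K * absLogHeight₁ (i y) := by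
    rw [h5]
    gcongr
  calc logHeight₁ y ≤ Module.finrank ℚ K * (3 * h) := h3
    _ ≤ Module.finrank ℚ K * (3 * (Module.finrank ℚ K * absLogHeight₁ (i y))) := by gcongr
    _ = _ := by ring

/-- **Kronecker's theorem**: a nonzero element of height zero is a root of unity. -/
lemma NumberField.exists_pow_eq_one_of_logHeight₁_eq_zero {α : K} (hα : α ≠ 0)
    (h : logHeight₁ α = 0) : ∃ d > 0, α ^ d = 1 := by
  have h1 : mulHeight₁ α = 1 := by
    rw [← exp_log (mulHeight₁_pos α), ← logHeight₁_eq_log_mulHeight₁, h, exp_zero]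
  -- All powers of α have height 1, so Northcott finiteness makes two of them equal.
  have hmaps : Set.MapsTo (fun n : ℕ => α ^ n) Set.univ {x : K | mulHeight₁ x ≤ 1} := by
    intro n _
    simp [mulHeight₁_pow, h1]
  obtain ⟨m, _, n, _, hmn, heq⟩ := Set.infinite_univ.exists_lt_map_eq_of_mapsTo hmaps
    (finite_setOfPred_mulHeight₁_le K 1)
  refine ⟨n - m, by omega, ?_⟩
  have h2 : α ^ m * α ^ (n - m) = α ^ m * 1 := by
    rw [← pow_add, mul_one, Nat.add_sub_cancel' hmn.le]
    exact heq.symm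
  exact mul_left_cancel₀ (pow_ne_zero _ hα) h2

open Polynomial in
/-- A geometric progression which is a fixed linear combination of shifts of a sequence of
sublinear height has a root of unity as its ratio. -/
lemma exists_pow_eq_one_of_moment {a : ℕ → K} {c C : ℝ} (hc0 : 0 < c) (hc1 : c < 1)
    (ha : ∀ n : ℕ, logHeight₁ (a n) ≤ C * ((n : ℝ) + 1) ^ c) {g : K[X]} {α : K} (hα : α ≠ 0)
    (hg0 : moment a g ≠ 0) (hg : ∀ n, moment a (X ^ n * g) = α ^ n * moment a g) :
    ∃ d > 0, α ^ d = 1 := by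
  refine NumberField.exists_pow_eq_one_of_logHeight₁_eq_zero hα ?_
  have hC : 0 ≤ C := by
    have h1 := (zero_le_logHeight₁ _).trans (ha 0)
    simpa using h1
  set s := Finset.range (g.natDegree + 1) with hs
  obtain ⟨B, hB⟩ : ∃ B, B = totalWeight K * log s.card + ∑ j ∈ s, logHeight₁ (g.coeff j) +
    logHeight₁ (moment a g) := ⟨_, rfl⟩
  obtain ⟨E, hE⟩ : ∃ E, E = (s.card : ℝ) * (C * ((g.natDegree : ℝ) + 2) ^ c) := ⟨_, rfl⟩
  -- The left side is the height of α ^ n, and α ^ n is a combination of boundedly many a (n + j);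
  -- division by n then gives height 0.
  have hbound : ∀ n : ℕ, 1 ≤ n → n * logHeight₁ α ≤ B + E * (n : ℝ) ^ c := by
    intro n hn
    have hn' : (1 : ℝ) ≤ n := by exact_mod_cast hn
    have h1 : α ^ n = moment a (X ^ n * g) * (moment a g)⁻¹ := by
      rw [hg, mul_inv_cancel_right₀ hg0]
    have h2 : logHeight₁ (moment a (X ^ n * g)) ≤ totalWeight K * log s.card +
        ∑ j ∈ s, (C * ((g.natDegree : ℝ) + 2) ^ c * (n : ℝ) ^ c + logHeight₁ (g.coeff j)) := by
      rw [moment_X_pow_mul]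
      refine (logHeight₁_sum_le _ _).trans ?_
      gcongr with j hj
      refine (logHeight₁_mul_le _ _).trans ?_
      gcongr
      refine (ha _).trans ?_
      rw [mul_assoc, ← mul_rpow (by positivity) (by positivity)]
      gcongr
      have hj' : (j : ℝ) ≤ g.natDegree := by
        exact_mod_cast Nat.lt_succ_iff.1 (Finset.mem_range.1 hj)
      push_cast
      nlinarith
    rw [Finset.sum_add_distrib, Finset.sum_const, nsmul_eq_mul] at h2
    have h3 := logHeight₁_mul_le (moment a (X ^ n * g)) (moment a g)⁻¹
    rw [← h1, logHeight₁_pow, logHeight₁_inv] at h3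
    rw [hB, hE]
    linarith
  refine le_antisymm ?_ (zero_le_logHeight₁ α)
  have hlim : Tendsto (fun n : ℕ => B * ((n : ℝ))⁻¹ + E * ((n : ℝ)) ^ (-(1 - c))) atTop
      (nhds (B * 0 + E * 0)) :=
    (tendsto_inv_atTop_zero.comp tendsto_natCast_atTop_atTop |>.const_mul B).add
      ((tendsto_rpow_neg_atTop (by linarith)).comp tendsto_natCast_atTop_atTop |>.const_mul E)
  rw [mul_zero, mul_zero, add_zero] at hlim
  refine ge_of_tendsto hlim ?_
  filter_upwards [eventually_ge_atTop 1] with n hn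
  have hn0 : (0 : ℝ) < n := by exact_mod_cast hn
  have h1 := hbound n hn
  have h2 : (n : ℝ) ^ (-(1 - c)) = (n : ℝ) ^ c * (n : ℝ)⁻¹ := by
    rw [← rpow_neg_one, ← rpow_add hn0]
    congr 1
    ring
  rw [h2, ← mul_assoc, ← add_mul, ← div_eq_mul_inv, le_div_iff₀ hn0]
  linarith

end AbsoluteHeight

/-! ### Descent to number fields. -/

section Descent

open Polynomial

lemma map_moment {F L : Type*} [Field F] [Field L] (φ : F →+* L) (a : ℕ → F) (p : F[X]) :
    φ (moment a p) = moment (fun n => φ (a n)) (p.map φ) := by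
  induction p using Polynomial.induction_on' with
  | add p q hp hq => simp [hp, hq]
  | monomial n c => simp

lemma det_hankel_map {R S : Type*} [CommRing R] [CommRing S] (φ : R →+* S) (a : ℕ → R) (N : ℕ) :
    (hankel (fun n => φ (a n)) N).det = φ (hankel a N).det := by
  rw [RingHom.map_det]
  rfl

lemma exists_map_eq_of_coeff_mem {L : Type*} [Field L] [Algebra ℚ L] (K : IntermediateField ℚ L)
    {σ : Type*} (p : MvPolynomial σ L) (h : ∀ c ∈ p.coeffs, c ∈ K) :
    ∃ q : MvPolynomial σ K, MvPolynomial.map (algebraMap K L) q = p := by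
  have : p ∈ Set.range (MvPolynomial.map (σ := σ) (algebraMap K L)) :=
    MvPolynomial.mem_range_map_iff_coeffs_subset.2 fun c hc => ⟨⟨c, h c hc⟩, rfl⟩
  exact this

lemma numberField_adjoin (T : Finset QBar) :
    NumberField (IntermediateField.adjoin ℚ (T : Set QBar)) := by
  have : FiniteDimensional ℚ (IntermediateField.adjoin ℚ (T : Set QBar)) :=
    IntermediateField.finiteDimensional_adjoin fun x _ =>
      ((AlgebraicClosure.isAlgebraic ℚ).isAlgebraic x).isIntegral
  exact {}

end Descent

/-! ### Orbits over the algebraic numbers. -/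

section Orbits

open NumberField Height Real

/-- The finitely many early heights go into C; the base n + 1 keeps the power at least 1 even at n =
0. -/
lemma exists_logHeight₁_le {K L : Type*} [Field K] [NumberField K] [Field L] [CharZero L]
    (i : K →+* L) (a : ℕ → K) {c : ℝ} (hc : 0 < c)
    (h : ∀ᶠ n : ℕ in atTop, absLogHeight₁ (i (a n)) ≤ (n : ℝ) ^ c) :
    ∃ C : ℝ, ∀ n : ℕ, logHeight₁ (a n) ≤ C * ((n : ℝ) + 1) ^ c := by
  obtain ⟨n₀, hn₀⟩ := eventually_atTop.1 h
  have hsum : 0 ≤ ∑ n ∈ Finset.range n₀, logHeight₁ (a n) :=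
    Finset.sum_nonneg fun _ _ => zero_le_logHeight₁ _
  refine ⟨3 * (Module.finrank ℚ K : ℝ) ^ 2 + ∑ n ∈ Finset.range n₀, logHeight₁ (a n),
    fun n => ?_⟩
  have h1 : (1 : ℝ) ≤ ((n : ℝ) + 1) ^ c := one_le_rpow (by linarith [n.cast_nonneg (α := ℝ)]) hc.le
  rcases lt_or_ge n n₀ with hn | hn
  · have h2 := Finset.single_le_sum (f := fun n => logHeight₁ (a n))
      (fun n _ => zero_le_logHeight₁ _) (Finset.mem_range.2 hn)
    have h3 : 0 ≤ 3 * (Module.finrank ℚ K : ℝ) ^ 2 := by positivity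
    calc logHeight₁ (a n) ≤ (3 * (Module.finrank ℚ K : ℝ) ^ 2 +
          ∑ n ∈ Finset.range n₀, logHeight₁ (a n)) * 1 := by linarith
      _ ≤ _ := by gcongr
  · calc logHeight₁ (a n) ≤ 3 * (Module.finrank ℚ K : ℝ) ^ 2 * absLogHeight₁ (i (a n)) :=
          logHeight₁_le_absLogHeight₁ i (a n)
      _ ≤ 3 * (Module.finrank ℚ K : ℝ) ^ 2 * ((n : ℝ) + 1) ^ c := by
          gcongr
          refine (hn₀ n hn).trans ?_
          gcongr
          linarith
      _ ≤ _ := by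
          gcongr
          linarith

/-- The sequence of values of a polynomial along an orbit lies in a number field, which moreover can
be enlarged to contain any given finite set. -/
lemma exists_orbitValue_eq_map {r : ℕ} (F : Fin r → MvPolynomial (Fin r) QBar)
    (G : MvPolynomial (Fin r) QBar) (P : Fin r → QBar) (U : Finset QBar) :
    ∃ K : IntermediateField ℚ QBar, NumberField K ∧ (∀ x ∈ U, x ∈ K) ∧
      ∃ (F' : Fin r → MvPolynomial (Fin r) K) (G' : MvPolynomial (Fin r) K) (P' : Fin r → K),
        ∀ n, orbitValue F G P n = algebraMap K QBar (orbitValue F' G' P' n) := by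
  classical
  let T : Finset QBar := (Finset.univ.biUnion fun i => (F i).coeffs) ∪ G.coeffs ∪
    Finset.univ.image P ∪ U
  let K := IntermediateField.adjoin ℚ (T : Set QBar)
  have hT : ∀ x ∈ T, x ∈ K := fun x hx => IntermediateField.subset_adjoin ℚ _ hx
  have hF : ∀ i, ∃ q : MvPolynomial (Fin r) K, MvPolynomial.map (algebraMap K QBar) q = F i := by
    refine fun i => exists_map_eq_of_coeff_mem K _ fun c hc => hT c ?_
    simp only [T, Finset.mem_union, Finset.mem_biUnion]
    exact Or.inl (Or.inl (Or.inl ⟨i, Finset.mem_univ _, hc⟩))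
  choose F' hF' using hF
  obtain ⟨G', hG'⟩ := exists_map_eq_of_coeff_mem K G fun c hc => hT c (by
    simp only [T, Finset.mem_union]
    exact Or.inl (Or.inl (Or.inr hc)))
  refine ⟨K, numberField_adjoin T, fun x hx => hT x (Finset.mem_union_right _ hx), F', G',
    fun i => ⟨P i, hT _ (by simp [T])⟩, fun n => ?_⟩
  rw [map_orbitValue, hG']
  simp_rw [hF']
  rfl

open Polynomial in
/-- If the height of the values along an orbit in affine `r`-space is eventually at most `n ^ c` with
`c < 1 / r`, then these values are eventually polynomial on residue classes. -/
theorem eventually_quasiPolynomial_orbitValue {r : ℕ} (hr : 0 < r)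
    (F : Fin r → MvPolynomial (Fin r) QBar) (G : MvPolynomial (Fin r) QBar) (P : Fin r → QBar)
    {c : ℝ} (hc0 : 0 < c) (hc : c < 1 / r)
    (h : ∀ᶠ n : ℕ in atTop, absLogHeight₁ (orbitValue F G P n) ≤ (n : ℝ) ^ c) :
    ∃ d : ℕ, 0 < d ∧ ∃ q : Fin d → QBar[X], ∀ᶠ n : ℕ in atTop, ∀ i : Fin d,
      orbitValue F G P (n * d + (i : ℕ)) = (q i).eval (n : QBar) := by
  set a := orbitValue F G P with ha
  have hc1 : c < 1 := hc.trans_le (by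
    rw [div_le_one (by exact_mod_cast hr)]
    exact_mod_cast hr)
  have hne : recurrenceIdeal a ≠ ⊥ := by
    obtain ⟨K, hK, _, F', G', P', hval⟩ := exists_orbitValue_eq_map F G P ∅
    obtain ⟨C, hC⟩ := exists_logHeight₁_le (algebraMap K QBar) (orbitValue F' G' P') hc0
      (by simpa only [← hval] using h)
    obtain ⟨N₀, hN₀⟩ := exists_forall_det_hankel_orbitValue_eq_zero F' G' P' hr hc0 hc hC
    refine recurrenceIdeal_ne_bot_of_det_hankel a ⟨N₀, fun N hN => ?_⟩
    have h1 := det_hankel_map (algebraMap K QBar) (orbitValue F' G' P') N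
    rw [hN₀ N hN, map_zero] at h1
    simpa only [← hval] using h1
  -- The generator is the minimal recurrence: a cofactor g of X - α in p is not a recurrence, so the
  -- moment of g is nonzero and shifts of g act by powers of α.
  obtain ⟨p, hp⟩ := IsPrincipalIdealRing.principal (recurrenceIdeal a)
  rw [Ideal.submodule_span_eq] at hp
  have hp0 : p ≠ 0 := by
    rintro rfl
    exact hne (by rw [hp, Ideal.span_singleton_eq_bot])
  have hpmem : p ∈ recurrenceIdeal a := hp ▸ Ideal.mem_span_singleton_self p
  refine eventually_quasiPolynomial_of_roots hp0 hpmem (IsAlgClosed.splits p) fun α hα hα0 => ?_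
  obtain ⟨g, hg⟩ := dvd_iff_isRoot.2 (isRoot_of_mem_roots hα)
  have hg0 : g ≠ 0 := by
    rintro rfl
    exact hp0 (by rw [hg, mul_zero])
  have hgnot : g ∉ recurrenceIdeal a := by
    rw [hp, Ideal.mem_span_singleton]
    intro hdvd
    have h1 := natDegree_le_of_dvd hdvd hg0
    rw [hg, natDegree_mul (X_sub_C_ne_zero α) hg0, natDegree_X_sub_C] at h1
    omega
  have hgeom : ∀ n, moment a (X ^ n * g) = α ^ n * moment a g := by
    intro n
    induction n with
    | zero => simp
    | succ n ih =>
      have h1 : X ^ (n + 1) * g = X ^ n * p + C α * (X ^ n * g) := by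
        rw [hg]
        ring
      rw [h1, map_add, hpmem, zero_add, ← smul_eq_C_mul, map_smul, ih, smul_eq_mul]
      ring
  have hmg : moment a g ≠ 0 := by
    intro h0
    refine hgnot (mem_recurrenceIdeal_of_X_pow fun n => ?_)
    rw [hgeom, h0, mul_zero]
  classical
  -- A larger number field, now also containing α and the coefficients of g.
  obtain ⟨K, hK, hU, F', G', P', hval⟩ := exists_orbitValue_eq_map F G P (insert α g.coeffs)
  obtain ⟨C, hC⟩ := exists_logHeight₁_le (algebraMap K QBar) (orbitValue F' G' P') hc0
    (by simpa only [← hval] using h)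
  obtain ⟨α', rfl⟩ : ∃ α' : K, algebraMap K QBar α' = α :=
    ⟨⟨α, hU α (Finset.mem_insert_self _ _)⟩, rfl⟩
  obtain ⟨g', rfl⟩ : ∃ g' : K[X], g'.map (algebraMap K QBar) = g := by
    have : g ∈ lifts (algebraMap K QBar) := by
      refine (lifts_iff_coeff_lifts g).2 fun n => ?_
      by_cases hn : g.coeff n = 0
      · exact ⟨0, by rw [map_zero, hn]⟩
      · exact ⟨⟨_, hU _ (Finset.mem_insert_of_mem (coeff_mem_coeffs hn))⟩, rfl⟩
    exact (mem_lifts g).1 this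
  have hmom : ∀ q : K[X], moment a (q.map (algebraMap K QBar)) =
      algebraMap K QBar (moment (orbitValue F' G' P') q) := by
    intro q
    rw [map_moment]
    simp only [← hval]
    rfl
  have hinj := (algebraMap K QBar).injective
  obtain ⟨d, hd, hαd⟩ := exists_pow_eq_one_of_moment hc0 hc1 hC (g := g') (α := α')
    (fun h0 => hα0 (by rw [h0, map_zero])) (fun h0 => hmg (by rw [hmom, h0, map_zero]))
    fun n => hinj (by
      have h1 := hgeom n
      rw [hmom, ← Polynomial.map_X (algebraMap K QBar), ← Polynomial.map_pow,
        ← Polynomial.map_mul, hmom, ← map_pow, ← map_mul] at h1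
      exact h1)
  exact ⟨d, hd, by rw [← map_pow, hαd, map_one]⟩

end Orbits

lemma eventually_absLogHeight₁_le_rpow {u : ℕ → QBar} {c : ℝ}
    (h : limsup (fun n : ℕ => logWeilHeight (u n) / ((Real.log n : ℝ) : EReal)) atTop < (c : EReal)) :
    ∀ᶠ n : ℕ in atTop, NumberField.absLogHeight₁ (u n) ≤ (n : ℝ) ^ c := by
  filter_upwards [eventually_lt_of_limsup_lt h, eventually_ge_atTop 2] with n hn hn2
  have hn1 : (1 : ℝ) < n := by exact_mod_cast hn2
  have hlog : 0 < Real.log n := Real.log_pos hn1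
  -- At height 0, where `logWeilHeight` is ⊥, the bound is trivial.
  rcases le_or_gt (NumberField.absLogHeight₁ (u n)) 0 with h0 | h0
  · exact h0.trans (by positivity)
  · rw [logWeilHeight, ENNReal.log_ofReal_of_pos h0, ← EReal.coe_div, EReal.coe_lt_coe_iff,
      div_lt_iff₀ hlog] at hn
    rw [← Real.log_le_log_iff h0 (by positivity), Real.log_rpow (by linarith)]
    exact hn.le

/-- Note on the right-hand side of `hP`: it is `1 / r`, read as `+∞` when `r = 0`. -/
theorem theorem1p4 (r : ℕ)
    (f : (Fin r → QBar) → (Fin r → QBar)) (hf : IsRegularMap f)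
    (l : (Fin r → QBar) → QBar) (hl : IsRegularFunction l)
    (P : Fin r → QBar)
    (hP : limsup (fun n : ℕ => logWeilHeight (l (f^[n] P)) / ((Real.log n : ℝ) : EReal)) atTop
      < ((1 / (r : ℝ≥0∞) : ℝ≥0∞) : EReal)) :
    ∃ d : ℕ, 0 < d ∧ ∃ p : Fin d → Polynomial QBar,
      ∀ᶠ n : ℕ in atTop, ∀ i : Fin d,
        l (f^[n * d + (i : ℕ)] P) = (p i).eval (n : QBar) := by
  -- For r = 0 affine space is a point and the sequence is constant.
  rcases Nat.eq_zero_or_pos r with rfl | hr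
  · refine ⟨1, one_pos, fun _ => Polynomial.C (l P), Eventually.of_forall fun n i => ?_⟩
    rw [Polynomial.eval_C]
    exact congrArg l (Subsingleton.elim _ _)
  obtain ⟨F, hF⟩ := hf
  obtain ⟨G, hG⟩ := hl
  have hfF : f = polyMap F := funext fun x => funext fun i => hF x i
  have hval : ∀ n, l (f^[n] P) = orbitValue F G P n := fun n => by rw [hG, hfF, orbitValue]
  have hr0 : (0 : ℝ) < r := by exact_mod_cast hr
  have hrhs : ((1 / (r : ℝ≥0∞) : ℝ≥0∞) : EReal) = ((1 / (r : ℝ) : ℝ) : EReal) := by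
    rw [← ENNReal.ofReal_natCast, ← ENNReal.ofReal_one, ← ENNReal.ofReal_div_of_pos hr0,
      EReal.coe_ennreal_ofReal, max_eq_left (by positivity)]
  rw [hrhs] at hP
  have hpos : ((0 : ℝ) : EReal) < ((1 / (r : ℝ) : ℝ) : EReal) :=
    EReal.coe_lt_coe_iff.2 (by positivity)
  -- The maximum with 0 forces c > 0, even if the limit superior is negative or -∞.
  obtain ⟨c, hc1, hc2⟩ := EReal.lt_iff_exists_real_btwn.1 (max_lt hP hpos)
  have hc0 : 0 < c := EReal.coe_lt_coe_iff.1 ((le_max_right _ _).trans_lt hc1)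
  have hbound := eventually_absLogHeight₁_le_rpow ((le_max_left _ _).trans_lt hc1)
  simp only [hval] at hbound ⊢
  exact eventually_quasiPolynomial_orbitValue hr F G P hc0 (EReal.coe_lt_coe_iff.1 hc2) hbound
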